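/- All graphs are finite and simple, $L(G)$ is the line graph of $G$, and $\lVert F\rVert$ is the spectral radius of a graph $F$, i.e. the maximum absolute value of an eigenvalue of its adjacency matrix. Let $G$ be a connected graph, $H=L(G)$, and let $\widetilde H=H+e$ be obtained from $H$ by adding one edge between two non-adjacent vertices. Let $\hat G$ be a pseudo-inverse of $\widetilde H$: a graph whose line graph $\hat H=L(\hat G)$, placed on the vertex set of $\widetilde H$, minimizes $\left|(E(F)\setminus E(\widetilde H))\cup(E(\widetilde H)\setminus E(F))\right|$ among all line graphs $F$ on that vertex set. Then there are real numbers $C_G$, depending only on the graphs $G,\hat G$, and $C_H$ and $C$, depending only on the graphs $H,\hat H$ and on $H,\widetilde H,\hat H$ respectively, such that the following hold. Case I: if $\hat H\cong\widetilde H$, then $0<C_G\le 1$, $0<C_H\le 1$ and $$\frac{\bigl|\lVert\hat G\rVert-\lVert G\rVert\bigr|}{C_G}\le\frac{\bigl|\lVert\hat H\rVert-\lVert H\rVert\bigr|}{C_H}\le 1 .$$ Case II: if $\hat H$ is obtained from $\widetilde H$ by deleting an edge and $\hat H\cong H$, then $\lVert\hat H\rVert=\lVert H\rVert$ and $\lVert\hat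 G\rVert=\lVert G\rVert$. Case III: if $\hat H$ is obtained from $\widetilde H$ by deleting an edge and $\hat H\not\cong H$, then $\bigl|\lVert\hat H\rVert-\lVert H\rVert\bigr|\le 1$ and $\bigl|\lVert\hat G\rVert-\lVert G\rVert\bigr|\le 2$. Case IV: if $\hat H$ is obtained from $\widetilde H$ by adding an edge, then $0<C\le\bigl|\lVert\hat H\rVert-\lVert H\rVert\bigr|\le 2$. -/

import Mathlib

universe u v

/-- The spectral radius of a finite graph: the maximum absolute value of an eigenvalue of its
adjacency matrix (the matrix is real symmetric, so that all its eigenvalues are real). -/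
noncomputable def graphNorm {V : Type u} [Finite V] (F : SimpleGraph V) : ℝ :=
  letI : Fintype V := Fintype.ofFinite V
  letI : DecidableEq V := Classical.decEq V
  letI : DecidableRel F.Adj := Classical.decRel _
  (spectralRadius ℝ (F.adjMatrix ℝ)).toReal

/-- `F'` is obtained from `F` by adding one new edge, keeping the vertices;
equivalently `F` is obtained from `F'` by deleting one edge. -/
def IsAddEdge {U : Type u} (F F' : SimpleGraph U) : Prop :=
  ∃ a b : U, a ≠ b ∧ ¬ F.Adj a b ∧ F' = F ⊔ SimpleGraph.edge a b

/-- `F` is, up to isomorphism, the line graph of some finite graph. -/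
def IsLineGraph {U : Type u} (F : SimpleGraph U) : Prop :=
  ∃ (n : ℕ) (R : SimpleGraph (Fin n)), Nonempty (R.lineGraph ≃g F)

/-- The number of edge additions and deletions needed to pass from one graph to another one with
the same vertices. -/
noncomputable def editDist {U : Type u} (F F' : SimpleGraph U) : ℕ :=
  ((F.edgeSet \ F'.edgeSet) ∪ (F'.edgeSet \ F.edgeSet)).ncard

/-- `Ghat` is a pseudo-inverse line graph of `Htilde`, where `Hhat` is the line graph of `Ghat`
placed on the vertices of `Htilde`: among all line graphs on these vertices, `Hhat` needs the
minimum number of edge additions and deletions from `Htilde`. -/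
structure IsPseudoInverse {U : Type u} {W : Type v} (Htilde : SimpleGraph U)
    (Ghat : SimpleGraph W) (Hhat : SimpleGraph U) : Prop where
  lineGraph_iso : Nonempty (Ghat.lineGraph ≃g Hhat)
  minimal : ∀ F : SimpleGraph U, IsLineGraph F → editDist Hhat Htilde ≤ editDist F Htilde

/-- The edge-augmented setting: `H = L(G)`, `Htilde = H + e`, `Ghat` is a pseudo-inverse of
`Htilde`, and `Hhat = L(Ghat)`. -/
structure EdgeAugmented {V : Type u} {W : Type v} (G : SimpleGraph V)
    (Htilde : SimpleGraph G.edgeSet) (Ghat : SimpleGraph W)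
    (Hhat : SimpleGraph G.edgeSet) : Prop where
  augment : IsAddEdge G.lineGraph Htilde
  pseudoInverse : IsPseudoInverse Htilde Ghat Hhat

/-! Spectral radii are handled through the quadratic form of the adjacency matrix, maximised at a
nonnegative vector. Since 2st ≤ s² + t², a new edge raises the radius by at most 1, and strictly if
the graph was connected (`graphNorm_lt_of_lt`). This settles every claim about H and Ĥ. The
constants may then be chosen as C_G = 1 and C_H = C = |‖Ĥ‖ - ‖H‖|, so Case I reduces to 0 < |‖Ĥ‖ -
‖H‖| ≤ 1 and |‖Ĝ‖ - ‖G‖| ≤ 1.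

The roots are compared by Whitney's argument. An injective map of edges that preserves and reflects
meeting is analysed on a component carrying the spectral radius: either that component embeds in the
target, or a claw goes to a triangle (harmless, since the radius does not drop), or an isolated
triangle goes to a claw, where up to 2 - √3 is lost (`IncidencePreserving.graphNorm_le`).

Line graphs differing in the edge ab agree away from a, so the roots match after deleting one edge
each, and restoring it costs at most 1. In the exceptional case connectedness attaches the deleted
edge to the triangle, which gives at most 1 + √3, again within 1 of the claw. In Case III two edges
are deleted; restoring them costs at most √2, and √2 + (2 - √3) ≤ 2. In Case II the exception would
make H complete, but H has two non-adjacent vertices. -/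

open Finset

/-! ### Spectral radius via the quadratic form: edge additions, Perron, small graphs. -/

section Form

variable {V : Type u} {W : Type v}

open Classical in
/-- The quadratic form of the adjacency matrix of a graph. -/
noncomputable def adjForm [Fintype V] (F : SimpleGraph V) (x : V → ℝ) : ℝ :=
  ∑ u, ∑ w, if F.Adj u w then x u * x w else 0

open Classical in
theorem exists_abs_eigenvalues_eq_graphNorm [Fintype V] [Nonempty V] (F : SimpleGraph V) :
    ∃ h : (F.adjMatrix ℝ).IsHermitian,
      (∃ i, |h.eigenvalues i| = graphNorm F) ∧ ∀ i, |h.eigenvalues i| ≤ graphNorm F := by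
  have hH : (F.adjMatrix ℝ).IsHermitian := by
    rw [Matrix.IsHermitian, Matrix.conjTranspose_eq_transpose_of_trivial]
    exact F.transpose_adjMatrix (α := ℝ)
  have hs := hH.spectrum_real_eq_range_eigenvalues
  obtain ⟨i, hi⟩ := Finite.exists_max (fun i => ‖hH.eigenvalues i‖₊)
  have hN : graphNorm F = (spectralRadius ℝ (F.adjMatrix ℝ)).toReal := by
    unfold graphNorm
    -- `graphNorm` chooses its own instances; they agree with the ambient ones because such
    -- instances are unique.
    congr!
  have hr : spectralRadius ℝ (F.adjMatrix ℝ) = ‖hH.eigenvalues i‖₊ := by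
    unfold spectralRadius
    apply le_antisymm
    · refine iSup₂_le fun k hk => ?_
      rw [hs] at hk
      obtain ⟨j, rfl⟩ := hk
      exact_mod_cast hi j
    · exact le_iSup₂ (f := fun (k : ℝ) (_ : k ∈ spectrum ℝ (F.adjMatrix ℝ)) => (‖k‖₊ : ENNReal))
        (hH.eigenvalues i) (hH.eigenvalues_mem_spectrum_real i)
  have hN' : graphNorm F = |hH.eigenvalues i| := by
    rw [hN, hr]; simp
  refine ⟨hH, ⟨i, hN'.symm⟩, fun j => ?_⟩
  rw [hN']
  exact_mod_cast hi j

theorem graphNorm_nonneg [Finite V] (F : SimpleGraph V) : 0 ≤ graphNorm F :=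
  ENNReal.toReal_nonneg

theorem graphNorm_of_isEmpty [Finite V] [IsEmpty V] (F : SimpleGraph V) : graphNorm F = 0 := by
  unfold graphNorm
  rw [spectralRadius]
  simp

open Classical in
theorem adjForm_eq_dotProduct [Fintype V] (F : SimpleGraph V) (x : V → ℝ) :
    adjForm F x = x ⬝ᵥ (F.adjMatrix ℝ).mulVec x := by
  simp [adjForm, dotProduct, Matrix.mulVec, mul_sum]

/-- Every eigenvalue of ‖F‖·1 - A has the form ‖F‖ - λ with |λ| ≤ ‖F‖, so this matrix is positive
semidefinite. -/
theorem adjForm_le [Fintype V] (F : SimpleGraph V) (x : V → ℝ) :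
    adjForm F x ≤ graphNorm F * ∑ u, x u ^ 2 := by
  classical
  cases isEmpty_or_nonempty V
  · simp [adjForm]
  obtain ⟨hH, -, hle⟩ := exists_abs_eigenvalues_eq_graphNorm F
  have hB : (algebraMap ℝ (Matrix V V ℝ) (graphNorm F) - F.adjMatrix ℝ).IsHermitian := by
    refine Matrix.IsHermitian.sub ?_ hH
    rw [Algebra.algebraMap_eq_smul_one]
    exact (Matrix.isHermitian_one).smul (by simp [IsSelfAdjoint])
  have hP : (algebraMap ℝ (Matrix V V ℝ) (graphNorm F) - F.adjMatrix ℝ).PosSemidef := by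
    rw [hB.posSemidef_iff_eigenvalues_nonneg]
    intro i
    have h := hB.eigenvalues_mem_spectrum_real i
    rw [← spectrum.singleton_sub_eq, hH.spectrum_real_eq_range_eigenvalues] at h
    obtain ⟨_, rfl, _, ⟨j, rfl⟩, h⟩ := h
    rw [← h]
    have := (abs_le.1 (hle j)).2
    simpa using this
  have h := hP.re_dotProduct_nonneg x
  simp only [Matrix.sub_mulVec, Algebra.algebraMap_eq_smul_one, Matrix.smul_mulVec,
    Matrix.one_mulVec, dotProduct_sub, star_trivial, dotProduct_smul, RCLike.re_to_real] at h
  rw [adjForm_eq_dotProduct]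
  have : x ⬝ᵥ x = ∑ u, x u ^ 2 := by simp [dotProduct, sq]
  rw [← this]
  simpa using h

open Classical in
theorem exists_eigenvector [Fintype V] [Nonempty V] (F : SimpleGraph V) :
    ∃ (y : V → ℝ) (μ : ℝ), y ≠ 0 ∧ |μ| = graphNorm F ∧
      ∀ u, ∑ w, (if F.Adj u w then y w else 0) = μ * y u := by
  obtain ⟨hH, ⟨i, hi⟩, -⟩ := exists_abs_eigenvalues_eq_graphNorm F
  refine ⟨fun u => hH.eigenvectorBasis i u, hH.eigenvalues i, fun h => ?_, hi, fun u => ?_⟩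
  · have := hH.eigenvectorBasis.orthonormal.ne_zero i
    exact this (by ext u; exact congrFun h u)
  · have := congrFun (hH.mulVec_eigenvectorBasis i) u
    simpa [Matrix.mulVec, dotProduct] using this

/-- The spectral radius is at least the absolute value of any eigenvalue. -/
theorem abs_le_graphNorm_of_eigenvector [Fintype V] (F : SimpleGraph V) {y : V → ℝ} {μ : ℝ}
    (hy : y ≠ 0) (h : ∀ u, (open Classical in ∑ w, (if F.Adj u w then y w else 0)) = μ * y u) :
    |μ| ≤ graphNorm F ∧ |μ| * ∑ u, |y u| ^ 2 ≤ adjForm F (fun u => |y u|) := by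
  classical
  have hpos : 0 < ∑ u, |y u| ^ 2 := by
    obtain ⟨u, hu⟩ := Function.ne_iff.1 hy
    exact sum_pos' (fun _ _ => by positivity) ⟨u, mem_univ _, by
      have : 0 < |y u| := abs_pos.2 hu
      positivity⟩
  -- The triangle inequality in the eigenvalue equation, multiplied by |y u| and summed over u.
  have key : |μ| * ∑ u, |y u| ^ 2 ≤ adjForm F (fun u => |y u|) := by
    rw [mul_sum, adjForm]
    refine sum_le_sum fun u _ => ?_
    have : |μ| * |y u| ^ 2 = |y u| * |∑ w, (if F.Adj u w then y w else 0)| := by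
      rw [h u, abs_mul]; ring
    rw [this]
    refine (mul_le_mul_of_nonneg_left (abs_sum_le_sum_abs _ _) (abs_nonneg _)).trans ?_
    rw [mul_sum]
    refine sum_le_sum fun w _ => ?_
    split_ifs <;> simp
  refine ⟨?_, key⟩
  have := key.trans (adjForm_le F _)
  exact le_of_mul_le_mul_right this hpos

/-- The spectral radius is attained by the quadratic form at a nonnegative vector. -/
theorem exists_nonneg_adjForm_eq [Fintype V] [Nonempty V] (F : SimpleGraph V) :
    ∃ x : V → ℝ, x ≠ 0 ∧ (∀ u, 0 ≤ x u) ∧ adjForm F x = graphNorm F * ∑ u, x u ^ 2 := by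
  obtain ⟨y, μ, hy, hμ, h⟩ := exists_eigenvector F
  refine ⟨fun u => |y u|, ?_, fun u => abs_nonneg _, le_antisymm (adjForm_le F _) ?_⟩
  · contrapose! hy
    ext u
    simpa using congrFun hy u
  · rw [← hμ]
    exact (abs_le_graphNorm_of_eigenvector F hy h).2

theorem sum_sq_pos_of_ne_zero [Fintype V] {x : V → ℝ} (hx : x ≠ 0) : 0 < ∑ u, x u ^ 2 := by
  obtain ⟨u, hu⟩ := Function.ne_iff.1 hx
  exact sum_pos' (fun _ _ => by positivity) ⟨u, mem_univ _, by
    have : x u ≠ 0 := hu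
    positivity⟩

/-- Nonnegative test vectors suffice because the radius is attained at one; every upper bound on a
radius below relies on this. -/
theorem graphNorm_le_of_adjForm_le [Fintype V] (F : SimpleGraph V) {c : ℝ} (hc : 0 ≤ c)
    (h : ∀ x : V → ℝ, (∀ u, 0 ≤ x u) → adjForm F x ≤ c * ∑ u, x u ^ 2) : graphNorm F ≤ c := by
  cases isEmpty_or_nonempty V
  · rwa [graphNorm_of_isEmpty]
  obtain ⟨x, hx, h0, hN⟩ := exists_nonneg_adjForm_eq F
  have := h x h0
  rw [hN] at this
  exact le_of_mul_le_mul_right this (sum_sq_pos_of_ne_zero hx)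

/-- The spectral radius is monotone under injective homomorphisms. -/
theorem graphNorm_le_of_injective_hom [Finite V] [Finite W] {F : SimpleGraph V}
    {F' : SimpleGraph W} (f : V → W) (hf : Function.Injective f)
    (hadj : ∀ u w, F.Adj u w → F'.Adj (f u) (f w)) : graphNorm F ≤ graphNorm F' := by
  classical
  cases nonempty_fintype V
  cases nonempty_fintype W
  refine graphNorm_le_of_adjForm_le F (graphNorm_nonneg F') fun x hx => ?_
  let y : W → ℝ := Function.extend f x 0
  have hy : ∀ u, y (f u) = x u := fun u => hf.extend_apply _ _ _
  have hy0 : ∀ w, w ∉ Set.range f → y w = 0 := fun w hw => Function.extend_apply' _ _ _ hw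
  have hypos : ∀ w, 0 ≤ y w := by
    intro w
    by_cases hw : w ∈ Set.range f
    · obtain ⟨u, rfl⟩ := hw
      rw [hy]; exact hx u
    · rw [hy0 w hw]
  have hsum : ∀ g : W → ℝ, (∀ w, w ∉ Set.range f → g w = 0) → ∑ u, g (f u) = ∑ w, g w := by
    intro g hg
    exact Fintype.sum_of_injective f hf _ _ hg fun _ => rfl
  have h2 : ∑ u, x u ^ 2 = ∑ w, y w ^ 2 := by
    rw [← hsum (fun w => y w ^ 2) (fun w hw => by simp [hy0 w hw])]
    simp [hy]
  have h1 : adjForm F x ≤ adjForm F' y := by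
    unfold adjForm
    rw [← hsum _ (fun w hw => by simp [hy0 w hw])]
    refine sum_le_sum fun u _ => ?_
    rw [← hsum _ (fun w hw => by simp [hy0 w hw])]
    refine sum_le_sum fun w _ => ?_
    rw [hy, hy]
    by_cases h : F.Adj u w
    · simp [h, hadj u w h]
    · rw [if_neg h]
      split_ifs
      · exact mul_nonneg (hx _) (hx _)
      · rfl
  rw [h2]
  exact h1.trans (adjForm_le F' y)

theorem graphNorm_mono [Finite V] {F F' : SimpleGraph V} (h : F ≤ F') :
    graphNorm F ≤ graphNorm F' :=
  graphNorm_le_of_injective_hom id Function.injective_id fun _ _ hadj => h hadj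

theorem graphNorm_congr [Finite V] [Finite W] {F : SimpleGraph V} {F' : SimpleGraph W}
    (e : F ≃g F') : graphNorm F = graphNorm F' :=
  le_antisymm (graphNorm_le_of_injective_hom e e.injective fun _ _ h => e.map_adj_iff.2 h)
    (graphNorm_le_of_injective_hom e.symm e.symm.injective fun _ _ h => e.symm.map_adj_iff.2 h)

/-- Not an equality: a and b may coincide or be adjacent already, and then nonnegativity of x
absorbs the extra term. -/
theorem adjForm_sup_edge_le [Fintype V] (F : SimpleGraph V) (a b : V) {x : V → ℝ}
    (hx : ∀ u, 0 ≤ x u) : adjForm (F ⊔ SimpleGraph.edge a b) x ≤ adjForm F x + 2 * (x a * x b) := by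
  classical
  have h : ∀ u w, (if (F ⊔ SimpleGraph.edge a b).Adj u w then x u * x w else 0) ≤
      (if F.Adj u w then x u * x w else 0) + ((if u = a then (if w = b then x a * x b else 0) else 0)
        + (if u = b then (if w = a then x a * x b else 0) else 0)) := by
    intro u w
    have h0 : 0 ≤ x u * x w := mul_nonneg (hx _) (hx _)
    have h1 : 0 ≤ x a * x b := mul_nonneg (hx _) (hx _)
    have h2 : 0 ≤ if u = a then (if w = b then x a * x b else 0) else 0 := by split_ifs <;> simp [h1]
    have h3 : 0 ≤ if u = b then (if w = a then x a * x b else 0) else 0 := by split_ifs <;> simp [h1]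
    by_cases hF : F.Adj u w
    · simp only [SimpleGraph.sup_adj, hF, true_or, if_true]
      linarith
    · by_cases he : (SimpleGraph.edge a b).Adj u w
      · simp only [SimpleGraph.sup_adj, he, or_true, if_true, hF, if_false]
        rw [SimpleGraph.edge_adj] at he
        rcases he.1 with ⟨rfl, rfl⟩ | ⟨rfl, rfl⟩
        · simp only [if_true] at *; linarith
        · simp only [if_true] at *; linarith
      · simp only [SimpleGraph.sup_adj, he, hF, or_self, if_false]
        linarith
  calc adjForm (F ⊔ SimpleGraph.edge a b) x
      ≤ ∑ u, ∑ w, ((if F.Adj u w then x u * x w else 0) +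
        ((if u = a then (if w = b then x a * x b else 0) else 0)
        + (if u = b then (if w = a then x a * x b else 0) else 0))) := by
        refine sum_le_sum fun u _ => sum_le_sum fun w _ => ?_
        refine (le_of_eq ?_).trans (h u w)
        congr
    _ = adjForm F x + 2 * (x a * x b) := by
        simp only [sum_add_distrib]
        have h1 : ∀ (a b : V) (t : ℝ),
            ∑ u, ∑ w, (if u = a then (if w = b then t else 0) else 0) = t := by
          intro a b t
          rw [sum_eq_single a (by intro u _ hu; simp [hu]) (by simp)]
          simp
        rw [h1, h1, adjForm]
        ring

theorem sq_add_sq_le_sum_sq [Fintype V] (x : V → ℝ) {a b : V} (h : a ≠ b) :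
    x a ^ 2 + x b ^ 2 ≤ ∑ u, x u ^ 2 := by
  classical
  rw [← sum_pair (f := fun u => x u ^ 2) h]
  exact sum_le_sum_of_subset_of_nonneg (subset_univ _) fun _ _ _ => sq_nonneg _

theorem graphNorm_sup_edge_le [Finite V] (F : SimpleGraph V) (a b : V) :
    graphNorm (F ⊔ SimpleGraph.edge a b) ≤ graphNorm F + 1 := by
  cases nonempty_fintype V
  by_cases hab : a = b
  · subst hab
    rw [SimpleGraph.sup_edge_self]; linarith
  refine graphNorm_le_of_adjForm_le _ (by have := graphNorm_nonneg F; linarith) fun x hx => ?_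
  have h1 := adjForm_sup_edge_le F a b hx
  have h2 := adjForm_le F x
  have h3 := sq_add_sq_le_sum_sq x hab
  nlinarith [sq_nonneg (x a - x b)]

/-- Adding two distinct edges increases the spectral radius by at most `√2`. -/
theorem graphNorm_sup_edge_sup_edge_le [Finite V] (F : SimpleGraph V) {a b c d : V}
    (h : s(a, b) ≠ s(c, d)) :
    graphNorm (F ⊔ SimpleGraph.edge a b ⊔ SimpleGraph.edge c d) ≤ graphNorm F + √2 := by
  classical
  cases nonempty_fintype V
  have hs : 1 ≤ √(2:ℝ) := by rw [Real.one_le_sqrt]; norm_num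
  by_cases hab : a = b
  · subst hab
    rw [SimpleGraph.sup_edge_self]
    have := graphNorm_sup_edge_le F c d
    linarith
  by_cases hcd : c = d
  · subst hcd
    rw [SimpleGraph.sup_edge_self]
    have := graphNorm_sup_edge_le F a b
    linarith
  have hs2 : √(2:ℝ) ^ 2 = 2 := Real.sq_sqrt (by norm_num)
  -- Two edges with a common end p form a path on three vertices, of spectral radius √2. Disjoint
  -- edges, treated last in `key`, contribute only 1.
  have path : ∀ (x : V → ℝ) {p q r : V}, p ≠ q → p ≠ r → q ≠ r →
      2 * (x p * x q) + 2 * (x p * x r) ≤ √2 * ∑ u, x u ^ 2 := by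
    intro x p q r hpq hpr hqr
    have h3 : x p ^ 2 + (x q ^ 2 + x r ^ 2) ≤ ∑ u, x u ^ 2 := by
      have : ∑ u ∈ {p, q, r}, x u ^ 2 ≤ ∑ u, x u ^ 2 :=
        sum_le_sum_of_subset_of_nonneg (subset_univ _) fun _ _ _ => sq_nonneg _
      rwa [sum_insert (by simp [hpq, hpr]), sum_pair hqr] at this
    have h4 := mul_le_mul_of_nonneg_left h3 (show 0 ≤ √(2:ℝ) by positivity)
    nlinarith [sq_nonneg (x p - √2 * x q), sq_nonneg (x p - √2 * x r), sq_nonneg (x q - x r),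
      mul_nonneg (show 0 ≤ √(2:ℝ) by positivity) (sq_nonneg (x p - √2 * x q)),
      mul_nonneg (show 0 ≤ √(2:ℝ) by positivity) (sq_nonneg (x p - √2 * x r))]
  have key : ∀ x : V → ℝ, 2 * (x a * x b) + 2 * (x c * x d) ≤ √2 * ∑ u, x u ^ 2 := by
    intro x
    by_cases hac : a = c
    · subst hac
      exact path x hab hcd (by rintro rfl; exact h rfl)
    by_cases had : a = d
    · subst had
      have := path x hab hac (by rintro rfl; exact h Sym2.eq_swap)
      linarith
    by_cases hbc : b = c
    · subst hbc
      have := path x (Ne.symm hab) hcd had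
      linarith
    by_cases hbd : b = d
    · subst hbd
      have := path x (Ne.symm hab) hbc hac
      linarith
    have h4 : x a ^ 2 + (x b ^ 2 + (x c ^ 2 + x d ^ 2)) ≤ ∑ u, x u ^ 2 := by
      have : ∑ u ∈ {a, b, c, d}, x u ^ 2 ≤ ∑ u, x u ^ 2 :=
        sum_le_sum_of_subset_of_nonneg (subset_univ _) fun _ _ _ => sq_nonneg _
      rwa [sum_insert (by simp [hab, hac, had]), sum_insert (by simp [hbc, hbd]),
        sum_pair hcd] at this
    have h5 : 0 ≤ ∑ u, x u ^ 2 := sum_nonneg fun _ _ => sq_nonneg _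
    nlinarith [sq_nonneg (x a - x b), sq_nonneg (x c - x d)]
  refine graphNorm_le_of_adjForm_le _ (by have := graphNorm_nonneg F; positivity) fun x hx => ?_
  have h1 := adjForm_sup_edge_le F a b hx
  have h1' := adjForm_sup_edge_le (F ⊔ SimpleGraph.edge a b) c d hx
  have h2 := adjForm_le F x
  have h3 := key x
  linarith

/-- Perron's theorem: the spectral radius of a connected graph increases strictly when edges are
added. -/
theorem graphNorm_lt_of_lt [Finite V] {F F' : SimpleGraph V} (hF : F.Preconnected) (h : F < F') :
    graphNorm F < graphNorm F' := by
  classical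
  cases nonempty_fintype V
  obtain ⟨a, b, hab', hab⟩ : ∃ a b, F'.Adj a b ∧ ¬ F.Adj a b := by
    by_contra! hcon
    exact h.not_ge fun a b hab => hcon a b hab
  have : Nonempty V := ⟨a⟩
  obtain ⟨x, hx, h0, hN⟩ := exists_nonneg_adjForm_eq F
  -- A maximiser cannot vanish next to a positive entry: raising x u from 0 to t gains at least 2t·x
  -- w in the form, at a cost of only ‖F‖t².
  have hstep : ∀ u w, F.Adj u w → x u = 0 → x w = 0 := by
    intro u w huw hu
    by_contra hw
    have hw : 0 < x w := lt_of_le_of_ne (h0 w) (Ne.symm hw)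
    have hN0 := graphNorm_nonneg F
    -- Maximality would force 2·x w ≤ ‖F‖t, whereas ‖F‖t < x w for this t; the +1 keeps the
    -- denominator positive.
    let t : ℝ := x w / (graphNorm F + 1)
    have ht : 0 < t := by positivity
    let y : V → ℝ := Function.update x u t
    have hyu : y u = t := by simp [y]
    have hyo : ∀ z, z ≠ u → y z = x z := fun z hz => by simp [y, hz]
    have hxy : ∀ z, x z ≤ y z := by
      intro z
      by_cases hz : z = u
      · subst hz; rw [hu, hyu]; exact ht.le
      · rw [hyo z hz]
    have hsq : ∑ z, y z ^ 2 = ∑ z, x z ^ 2 + t ^ 2 := by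
      rw [← add_sum_erase univ _ (mem_univ u), ← add_sum_erase univ (fun z => x z ^ 2) (mem_univ u),
        sum_congr rfl fun z hz => by rw [hyo z (mem_erase.1 hz).1], hyu, hu]
      ring
    have hform : adjForm F x + 2 * (t * x w) ≤ adjForm F y := by
      have hsplit : adjForm F x + 2 * (t * x w) = ∑ p, ∑ q, ((if F.Adj p q then x p * x q else 0) +
          ((if p = u then (if q = w then t * x w else 0) else 0)
          + (if p = w then (if q = u then t * x w else 0) else 0))) := by
        simp only [sum_add_distrib]
        have h1 : ∀ (a b : V) (t : ℝ),
            ∑ u, ∑ w, (if u = a then (if w = b then t else 0) else 0) = t := by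
          intro a b t
          rw [sum_eq_single a (by intro u _ hu; simp [hu]) (by simp)]
          simp
        rw [h1, h1, adjForm]
        ring
      rw [hsplit]
      refine sum_le_sum fun p _ => sum_le_sum fun q _ => ?_
      have hwu : w ≠ u := huw.ne'
      by_cases hpq : F.Adj p q
      · simp only [hpq, if_true]
        by_cases hp : p = u
        · subst hp
          rw [hu, hyu, if_neg hwu.symm]
          by_cases hq : q = w
          · subst hq; simp [hyo _ hwu]
          · simpa [hq] using mul_nonneg ht.le ((h0 q).trans (hxy q))
        · by_cases hq : q = u
          · subst hq
            rw [hu, hyu, if_neg hp]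
            by_cases hp' : p = w
            · subst hp'; simp [hyo _ hp, mul_comm]
            · simpa [hp'] using mul_nonneg ((h0 p).trans (hxy p)) ht.le
          · simp [hp, hq, hyo]
      · simp only [hpq, if_false]
        have h1 : ¬ (p = u ∧ q = w) := by rintro ⟨rfl, rfl⟩; exact hpq huw
        have h2 : ¬ (p = w ∧ q = u) := by rintro ⟨rfl, rfl⟩; exact hpq huw.symm
        rw [← ite_and, ← ite_and, if_neg h1, if_neg h2]
        simp
    have hle := hform.trans (adjForm_le F y)
    rw [hN, hsq] at hle
    have h5 : 2 * x w ≤ graphNorm F * t := by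
      have : t * (2 * x w) ≤ t * (graphNorm F * t) := by linarith
      exact le_of_mul_le_mul_left this ht
    have h6 : (graphNorm F + 1) * t = x w := by
      simp only [t]; field_simp
    linarith
  have hpos : ∀ u, x u ≠ 0 := by
    intro u hu
    apply hx
    ext w
    obtain ⟨p⟩ := hF u w
    induction p with
    | nil => exact hu
    | cons hadj p ih => exact ih (hstep _ _ hadj hu)
  have hlt : adjForm F x < adjForm F' x := by
    have hle : ∀ p q, (if F.Adj p q then x p * x q else 0) ≤
        if F'.Adj p q then x p * x q else 0 := by
      intro p q
      by_cases hpq : F.Adj p q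
      · simp [hpq, h.le hpq]
      · rw [if_neg hpq]
        split_ifs
        · exact mul_nonneg (h0 _) (h0 _)
        · rfl
    refine sum_lt_sum (fun p _ => sum_le_sum fun q _ => hle p q) ⟨a, mem_univ _, ?_⟩
    refine sum_lt_sum (fun q _ => hle a q) ⟨b, mem_univ _, ?_⟩
    rw [if_neg hab, if_pos hab']
    exact mul_pos (lt_of_le_of_ne (h0 _) (hpos _).symm) (lt_of_le_of_ne (h0 _) (hpos _).symm)
  rw [hN] at hlt
  exact lt_of_mul_lt_mul_right (hlt.trans_le (adjForm_le F' x)) (sum_sq_pos_of_ne_zero hx).le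

/-- Some connected component has the spectral radius of the whole graph. -/
theorem exists_component_graphNorm_le [Finite V] [Nonempty V] (F : SimpleGraph V) :
    ∃ C : F.ConnectedComponent, graphNorm F ≤ graphNorm C.toSimpleGraph := by
  classical
  cases nonempty_fintype V
  obtain ⟨y, μ, hy, hμ, h⟩ := exists_eigenvector F
  obtain ⟨a, ha⟩ := Function.ne_iff.1 hy
  -- Since y a ≠ 0, restricting y to the component of a leaves an eigenvector for the same μ.
  let C := F.connectedComponentMk a
  refine ⟨C, ?_⟩
  cases nonempty_fintype C
  rw [← hμ]
  refine (abs_le_graphNorm_of_eigenvector C.toSimpleGraph (y := fun u => y u.1) ?_ fun u => ?_).1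
  · exact Function.ne_iff.2 ⟨⟨a, rfl⟩, ha⟩
  · rw [← h u.1]
    obtain ⟨u, hu⟩ := u
    refine Fintype.sum_of_injective Subtype.val Subtype.val_injective _ _ (fun w hw => ?_) fun w => ?_
    · rw [if_neg]
      intro hadj
      exact hw ⟨⟨w, C.mem_supp_of_adj_mem_supp hu hadj⟩, rfl⟩
    · simp [SimpleGraph.ConnectedComponent.toSimpleGraph]

theorem adjForm_mono [Fintype V] {F F' : SimpleGraph V} (h : F ≤ F') {x : V → ℝ}
    (hx : ∀ u, 0 ≤ x u) : adjForm F x ≤ adjForm F' x := by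
  classical
  refine sum_le_sum fun p _ => sum_le_sum fun q _ => ?_
  by_cases hpq : F.Adj p q
  · simp [hpq, h hpq]
  · rw [if_neg hpq]
    split_ifs
    · exact mul_nonneg (hx _) (hx _)
    · rfl

theorem sum_sq_triple_le [Fintype V] (x : V → ℝ) {p q r : V} (hpq : p ≠ q) (hpr : p ≠ r)
    (hqr : q ≠ r) : x p ^ 2 + x q ^ 2 + x r ^ 2 ≤ ∑ u, x u ^ 2 := by
  classical
  have : ∑ u ∈ {p, q, r}, x u ^ 2 ≤ ∑ u, x u ^ 2 :=
    sum_le_sum_of_subset_of_nonneg (subset_univ _) fun _ _ _ => sq_nonneg _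
  rwa [sum_insert (by simp [hpq, hpr]), sum_pair hqr, ← add_assoc] at this

/-- A graph whose edges all lie in a triangle has spectral radius at most two. -/
theorem graphNorm_le_two_of_edges_in_triangle [Finite V] {F : SimpleGraph V} {x y z : V}
    (hxy : x ≠ y) (hxz : x ≠ z) (hyz : y ≠ z)
    (h : F ≤ SimpleGraph.edge x y ⊔ SimpleGraph.edge x z ⊔ SimpleGraph.edge y z) :
    graphNorm F ≤ 2 := by
  classical
  cases nonempty_fintype V
  refine graphNorm_le_of_adjForm_le _ (by norm_num) fun v hv => ?_
  have h0 := adjForm_mono h hv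
  have h1 := adjForm_sup_edge_le (SimpleGraph.edge x y ⊔ SimpleGraph.edge x z) y z hv
  have h2 := adjForm_sup_edge_le (SimpleGraph.edge x y) x z hv
  have h3 := adjForm_sup_edge_le (⊥ : SimpleGraph V) x y hv
  rw [bot_sup_eq] at h3
  have h4 : adjForm (⊥ : SimpleGraph V) v = 0 := by simp [adjForm]
  have h5 := sum_sq_triple_le v hxy hxz hyz
  nlinarith [sq_nonneg (v x - v y), sq_nonneg (v x - v z), sq_nonneg (v y - v z)]

/-- A graph containing a claw has spectral radius at least `√3`. -/
theorem sqrt_three_le_graphNorm_of_claw [Finite V] {F : SimpleGraph V} {p q r s : V}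
    (hq : F.Adj p q) (hr : F.Adj p r) (hs : F.Adj p s) (hqr : q ≠ r) (hqs : q ≠ s) (hrs : r ≠ s) :
    √3 ≤ graphNorm F := by
  classical
  let K : SimpleGraph (Fin 4) :=
    { Adj := fun i j => i = 0 ∧ j ≠ 0 ∨ i ≠ 0 ∧ j = 0
      symm := ⟨fun i j h => by tauto⟩
      loopless := ⟨fun i h => by tauto⟩ }
  have hK : √3 ≤ graphNorm K := by
    -- This is the eigenvector of the claw for √3: the form is 6√3 and the squared length 6.
    have h := adjForm_le K ![√3, 1, 1, 1]
    simp [adjForm, Fin.sum_univ_four, K] at h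
    have h3 : √(3:ℝ) ^ 2 = 3 := Real.sq_sqrt (by norm_num)
    nlinarith
  refine hK.trans (graphNorm_le_of_injective_hom ![p, q, r, s] ?_ ?_)
  · intro i j
    have := hq.ne; have := hr.ne; have := hs.ne
    fin_cases i <;> fin_cases j <;> simp_all [eq_comm]
  · intro i j hij
    have := hq.symm; have := hr.symm; have := hs.symm
    fin_cases i <;> fin_cases j <;> simp_all [K]

/-- Attaching a pendant edge to an isolated triangle of a graph of spectral radius at most two. -/
theorem graphNorm_sup_edge_le_of_isolated_triangle [Finite V] {K : SimpleGraph V} {x y z w : V}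
    (hxy : x ≠ y) (hxz : x ≠ z) (hyz : y ≠ z) (hwx : w ≠ x) (hwy : w ≠ y) (hwz : w ≠ z)
    (hx : ∀ u, K.Adj x u → u = y ∨ u = z) (hy : ∀ u, K.Adj y u → u = x ∨ u = z)
    (hz : ∀ u, K.Adj z u → u = x ∨ u = y) (hK : graphNorm K ≤ 2) :
    graphNorm (K ⊔ SimpleGraph.edge x w) ≤ 1 + √3 := by
  classical
  cases nonempty_fintype V
  have hs2 : √(3:ℝ) ^ 2 = 3 := Real.sq_sqrt (by norm_num)
  have hs0 : (1.7:ℝ) ≤ √3 := by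
    apply Real.le_sqrt_of_sq_le; norm_num
  refine graphNorm_le_of_adjForm_le _ (by positivity) fun v hv => ?_
  let T : Finset V := {x, y, z}
  have hT : ∀ u, u ∈ T ↔ u = x ∨ u = y ∨ u = z := by simp [T]
  -- The form splits into the triangle T, the new edge xw, and the rest `K'`, which sees only the
  -- part `v'` of v outside T.
  let K' : SimpleGraph V :=
    { Adj := fun p q => K.Adj p q ∧ p ∉ T ∧ q ∉ T
      symm := ⟨fun p q h => ⟨h.1.symm, h.2.2, h.2.1⟩⟩
      loopless := ⟨fun p h => K.loopless.irrefl p h.1⟩ }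
  let v' : V → ℝ := fun u => if u ∈ T then 0 else v u
  have hv' : ∀ u, 0 ≤ v' u := by
    intro u; simp only [v']; split_ifs; exacts [le_rfl, hv u]
  have hle : K ≤ K' ⊔ SimpleGraph.edge x y ⊔ SimpleGraph.edge x z ⊔ SimpleGraph.edge y z := by
    intro p q hpq
    have hne := hpq.ne
    by_cases hp : p ∈ T
    · rw [hT] at hp
      simp only [SimpleGraph.sup_adj, SimpleGraph.edge_adj]
      rcases hp with rfl | rfl | rfl
      · rcases hx q hpq with rfl | rfl <;> simp [hne, hne.symm]
      · rcases hy q hpq with rfl | rfl <;> simp [hne, hne.symm]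
      · rcases hz q hpq with rfl | rfl <;> simp [hne, hne.symm]
    · by_cases hq : q ∈ T
      · rw [hT] at hq
        simp only [SimpleGraph.sup_adj, SimpleGraph.edge_adj]
        rcases hq with rfl | rfl | rfl
        · rcases hx p hpq.symm with rfl | rfl <;> simp [hne, hne.symm]
        · rcases hy p hpq.symm with rfl | rfl <;> simp [hne, hne.symm]
        · rcases hz p hpq.symm with rfl | rfl <;> simp [hne, hne.symm]
      · exact Or.inl (Or.inl (Or.inl ⟨hpq, hp, hq⟩))
  have h1 := adjForm_sup_edge_le K x w hv
  have h2 := adjForm_mono hle hv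
  have h3 := adjForm_sup_edge_le (K' ⊔ SimpleGraph.edge x y ⊔ SimpleGraph.edge x z) y z hv
  have h4 := adjForm_sup_edge_le (K' ⊔ SimpleGraph.edge x y) x z hv
  have h5 := adjForm_sup_edge_le K' x y hv
  have h6 : adjForm K' v = adjForm K' v' := by
    refine sum_congr rfl fun p _ => sum_congr rfl fun q _ => ?_
    by_cases h : K'.Adj p q
    · simp [v', h.2.1, h.2.2]
    · simp [h]
  have h7 : adjForm K' v' ≤ adjForm K v' := adjForm_mono (F := K') (F' := K) (fun p q h => h.1) hv'
  have h8 := adjForm_le K v'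
  have hsum : ∑ u, v u ^ 2 = (v x ^ 2 + v y ^ 2 + v z ^ 2) + ∑ u, v' u ^ 2 := by
    have : ∀ u, v u ^ 2 = (if u ∈ T then v u ^ 2 else 0) + v' u ^ 2 := by
      intro u; simp only [v']; split_ifs <;> simp
    rw [sum_congr rfl fun u _ => this u, sum_add_distrib, sum_ite_mem, univ_inter,
      sum_insert (by simp [hxy, hxz]), sum_pair hyz, ← add_assoc]
  have hw : v w ^ 2 ≤ ∑ u, v' u ^ 2 := by
    have hwT : w ∉ T := by rw [hT]; tauto
    have : v w = v' w := by simp [v', hwT]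
    rw [this]
    exact single_le_sum (f := fun u => v' u ^ 2) (fun _ _ => sq_nonneg _) (mem_univ w)
  rw [hsum]
  set R := ∑ u, v' u ^ 2
  have hR : 0 ≤ R := (sq_nonneg _).trans hw
  have h9 : graphNorm K * R ≤ 2 * R := mul_le_mul_of_nonneg_right hK hR
  have h10 : (√3 - 1) * v w ^ 2 ≤ (√3 - 1) * R := mul_le_mul_of_nonneg_left hw (by linarith)
  -- The rest uses 2 of the allowed 1 + √3, leaving √3 - 1 for w. As (√3 - 1)(1 + √3)/2 = 1, the
  -- edge xw then charges x exactly half its allowance; `h12` fits the triangle into the other half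
  -- and the full allowances of y and z.
  have h11 : 2 * (v x * v w) ≤ (√3 - 1) * v w ^ 2 + (1 + √3) / 2 * v x ^ 2 := by
    have : 0 ≤ (√3 - 1) * (v w - (1 + √3) / 2 * v x) ^ 2 :=
      mul_nonneg (by linarith) (sq_nonneg _)
    nlinarith
  have h12 : 2 * (v x * v y + v x * v z + v y * v z) ≤
      (1 + √3) / 2 * v x ^ 2 + (1 + √3) * (v y ^ 2 + v z ^ 2) := by
    have hs3 : √(3:ℝ) ≤ 2 := by
      rw [Real.sqrt_le_left (by norm_num)]; norm_num
    have e1 : 2 * (v x * (v y + v z)) ≤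
        (1 + √3) / 2 * v x ^ 2 + (√3 - 1) * (v y + v z) ^ 2 := by
      have : 0 ≤ (√3 - 1) * ((v y + v z) - (1 + √3) / 2 * v x) ^ 2 :=
        mul_nonneg (by linarith) (sq_nonneg _)
      nlinarith
    have e2 : 0 ≤ (√3 - 1) * (v y - v z) ^ 2 := mul_nonneg (by linarith) (sq_nonneg _)
    have e3 : 0 ≤ (2 - √3) * (v y ^ 2 + v z ^ 2) := mul_nonneg (by linarith) (by positivity)
    nlinarith [sq_nonneg (v y - v z)]
  nlinarith

end Form


/-! ### Whitney's theorem for incidence preserving maps of edges. -/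

section Whitney

variable {V : Type u} {W : Type v}

/-- A map that sends the edges of `G` injectively to edges of `G'`, in such a way that two
edges meet if and only if their images do. -/
structure IncidencePreserving (G : SimpleGraph V) (G' : SimpleGraph W) (φ : Sym2 V → Sym2 W) :
    Prop where
  mem : ∀ e ∈ G.edgeSet, φ e ∈ G'.edgeSet
  injOn : Set.InjOn φ G.edgeSet
  meet : ∀ e ∈ G.edgeSet, ∀ f ∈ G.edgeSet, e ≠ f →
    ((∃ p, p ∈ φ e ∧ p ∈ φ f) ↔ ∃ x, x ∈ e ∧ x ∈ f)

theorem SimpleGraph.Preconnected.mem_of_closed {G : SimpleGraph V} (hG : G.Preconnected)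
    {S : Set V} {a : V} (ha : a ∈ S) (hS : ∀ u w, u ∈ S → G.Adj u w → w ∈ S) (u : V) : u ∈ S := by
  obtain ⟨p⟩ := hG a u
  induction p with
  | nil => exact ha
  | cons hadj p ih => exact ih (hS _ _ ha hadj)

namespace IncidencePreserving

variable {G : SimpleGraph V} {G' : SimpleGraph W} {φ : Sym2 V → Sym2 W}

theorem exists_common (h : IncidencePreserving G G' φ) {x a b : V} (ha : G.Adj x a)
    (hb : G.Adj x b) (hab : a ≠ b) : ∃ p, p ∈ φ s(x, a) ∧ p ∈ φ s(x, b) :=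
  (h.meet s(x, a) ha s(x, b) hb (mt Sym2.congr_right.1 hab)).2 ⟨x, by simp, by simp⟩

/-- Distinct edges share at most one vertex. -/
theorem eq_of_mem (h : IncidencePreserving G G' φ) {e f : Sym2 V} (he : e ∈ G.edgeSet)
    (hf : f ∈ G.edgeSet) (hef : e ≠ f) {p q : W} (hpe : p ∈ φ e) (hpf : p ∈ φ f) (hqe : q ∈ φ e)
    (hqf : q ∈ φ f) : p = q := by
  by_contra hpq
  apply hef
  apply h.injOn he hf
  rw [(Sym2.mem_and_mem_iff hpq).1 ⟨hpe, hqe⟩, (Sym2.mem_and_mem_iff hpq).1 ⟨hpf, hqf⟩]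

/-- Take common vertices p, q, r of the three pairs of images. Any coincidence gives a vertex on all
three; otherwise they span a triangle. This dichotomy produces Whitney's exceptions. -/
theorem common_or_triangle (h : IncidencePreserving G G' φ) {x a b c : V} (ha : G.Adj x a)
    (hb : G.Adj x b) (hc : G.Adj x c) (hab : a ≠ b) (hac : a ≠ c) (hbc : b ≠ c) :
    (∃ p, p ∈ φ s(x, a) ∧ p ∈ φ s(x, b) ∧ p ∈ φ s(x, c)) ∨
    ∃ p q r, p ≠ q ∧ p ≠ r ∧ q ≠ r ∧ φ s(x, a) = s(p, q) ∧ φ s(x, b) = s(p, r) ∧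
      φ s(x, c) = s(q, r) := by
  obtain ⟨p, hpa, hpb⟩ := h.exists_common ha hb hab
  obtain ⟨q, hqa, hqc⟩ := h.exists_common ha hc hac
  obtain ⟨r, hrb, hrc⟩ := h.exists_common hb hc hbc
  by_cases hpc : p ∈ φ s(x, c)
  · exact Or.inl ⟨p, hpa, hpb, hpc⟩
  have hpq : p ≠ q := by rintro rfl; exact hpc hqc
  have hpr : p ≠ r := by rintro rfl; exact hpc hrc
  by_cases hqr : q = r
  · subst hqr
    exact Or.inl ⟨q, hqa, hrb, hqc⟩
  exact Or.inr ⟨p, q, r, hpq, hpr, hqr, (Sym2.mem_and_mem_iff hpq).1 ⟨hpa, hqa⟩,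
    (Sym2.mem_and_mem_iff hpr).1 ⟨hpb, hrb⟩, (Sym2.mem_and_mem_iff hqr).1 ⟨hqc, hrc⟩⟩

/-- An edge that touches a claw mapped to a triangle joins two leaves of the claw. -/
theorem edge_of_claw_to_triangle (h : IncidencePreserving G G' φ) {x a b c : V}
    (ha : G.Adj x a) (hb : G.Adj x b) (hc : G.Adj x c) (hab : a ≠ b) (hac : a ≠ c) (hbc : b ≠ c)
    {p q r : W} (hpq : p ≠ q) (hpr : p ≠ r) (hqr : q ≠ r) (hφa : φ s(x, a) = s(p, q))
    (hφb : φ s(x, b) = s(p, r)) (hφc : φ s(x, c) = s(q, r)) {e : Sym2 V} (he : e ∈ G.edgeSet)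
    (hea : e ≠ s(x, a)) (heb : e ≠ s(x, b)) (hec : e ≠ s(x, c))
    (ht : x ∈ e ∨ a ∈ e ∨ b ∈ e ∨ c ∈ e) :
    p ∈ φ e ∧ e = s(a, b) ∨ q ∈ φ e ∧ e = s(a, c) ∨ r ∈ φ e ∧ e = s(b, c) := by
  have ma := h.meet e he s(x, a) ha hea
  have mb := h.meet e he s(x, b) hb heb
  have mc := h.meet e he s(x, c) hc hec
  rw [hφa] at ma
  rw [hφb] at mb
  rw [hφc] at mc
  simp only [Sym2.mem_iff, and_or_left, exists_or, exists_eq_right] at ma mb mc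
  have npq : ¬ (p ∈ φ e ∧ q ∈ φ e) := fun hh => hea (h.injOn he ha (by
    rw [(Sym2.mem_and_mem_iff hpq).1 hh, hφa]))
  have npr : ¬ (p ∈ φ e ∧ r ∈ φ e) := fun hh => heb (h.injOn he hb (by
    rw [(Sym2.mem_and_mem_iff hpr).1 hh, hφb]))
  have nqr : ¬ (q ∈ φ e ∧ r ∈ φ e) := fun hh => hec (h.injOn he hc (by
    rw [(Sym2.mem_and_mem_iff hqr).1 hh, hφc]))
  -- The image of e contains at most one of p, q, r, and at least one since e touches the claw. If
  -- it is p, then e meets xa and xb but not xc, so e avoids x and contains a and b; the other cases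
  -- are alike.
  have key : p ∈ φ e ∧ (a ∈ e ∧ b ∈ e) ∨ q ∈ φ e ∧ (a ∈ e ∧ c ∈ e) ∨
      r ∈ φ e ∧ (b ∈ e ∧ c ∈ e) := by
    clear hea heb hec hφa hφb hφc ha hb hc hab hac hbc hpq hpr hqr he
    grind
  rwa [Sym2.mem_and_mem_iff hab, Sym2.mem_and_mem_iff hac, Sym2.mem_and_mem_iff hbc] at key

/-- Every further edge joins two leaves, so x, a, b, c are all the vertices. With φ(ab) = pt, the
embedding is x ↦ p, a ↦ q, b ↦ r, c ↦ t. It does not induce φ itself, but φ with the opposite edges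
ab and xc interchanged. -/
theorem exists_injective_of_claw_to_triangle_of_adj (h : IncidencePreserving G G' φ)
    (hG : G.Preconnected) {x a b c : V}
    (ha : G.Adj x a) (hb : G.Adj x b) (hc : G.Adj x c) (hab : a ≠ b) (hac : a ≠ c) (hbc : b ≠ c)
    {p q r : W} (hpq : p ≠ q) (hpr : p ≠ r) (hqr : q ≠ r) (hφa : φ s(x, a) = s(p, q))
    (hφb : φ s(x, b) = s(p, r)) (hφc : φ s(x, c) = s(q, r)) (hadj : G.Adj a b) :
    ∃ f : V → W, Function.Injective f ∧ ∀ u w, G.Adj u w → G'.Adj (f u) (f w) := by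
  classical
  have hxa := ha.ne
  have hxb := hb.ne
  have hxc := hc.ne
  have hedge := fun {e : Sym2 V} => h.edge_of_claw_to_triangle (e := e) ha hb hc hab hac hbc hpq hpr
    hqr hφa hφb hφc
  have hall : ∀ u, u = x ∨ u = a ∨ u = b ∨ u = c := by
    refine hG.mem_of_closed (S := {u | u = x ∨ u = a ∨ u = b ∨ u = c}) (a := x) (Or.inl rfl) ?_
    intro u w hu huw
    simp only [Set.mem_ofPred_eq] at hu ⊢
    by_cases h1 : s(u, w) = s(x, a)
    · rw [Sym2.eq_iff] at h1; tauto
    by_cases h2 : s(u, w) = s(x, b)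
    · rw [Sym2.eq_iff] at h2; tauto
    by_cases h3 : s(u, w) = s(x, c)
    · rw [Sym2.eq_iff] at h3; tauto
    have := hedge (e := s(u, w)) huw h1 h2 h3 (by
      rcases hu with rfl | rfl | rfl | rfl <;> simp)
    simp only [Sym2.eq_iff] at this
    tauto
  have hφab : p ∈ φ s(a, b) := by
    rcases hedge (e := s(a, b)) hadj (by simp; tauto) (by simp; tauto) (by simp; tauto) (by simp)
      with hh | hh | hh
    · exact hh.1
    · exact absurd hh.2 (by simp [hbc, hac])
    · exact absurd hh.2 (by simp [hab, hac])
  obtain ⟨t, ht⟩ := hφab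
  have hpt : G'.Adj p t := by
    have := h.mem s(a, b) hadj
    rwa [ht] at this
  have hpq' : G'.Adj p q := by
    have := h.mem s(x, a) ha
    rwa [hφa] at this
  have hpr' : G'.Adj p r := by
    have := h.mem s(x, b) hb
    rwa [hφb] at this
  have hqr' : G'.Adj q r := by
    have := h.mem s(x, c) hc
    rwa [hφc] at this
  have htq : t ≠ q := by
    rintro rfl
    have := h.injOn (x₁ := s(a, b)) (x₂ := s(x, a)) hadj ha (by rw [ht, hφa])
    simp [hxb.symm, hxa.symm] at this
  have htr : t ≠ r := by
    rintro rfl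
    have := h.injOn (x₁ := s(a, b)) (x₂ := s(x, b)) hadj hb (by rw [ht, hφb])
    simp [hxb.symm, hxa.symm] at this
  -- The image of ac contains q and meets pt; it cannot be pq, which is already the image of xa, so
  -- it is qt.
  have hqt : G.Adj a c → G'.Adj q t := by
    intro hadj'
    have hq : q ∈ φ s(a, c) := by
      rcases hedge (e := s(a, c)) hadj' (by simp; tauto) (by simp; tauto) (by simp; tauto) (by simp)
        with hh | hh | hh
      · exact absurd hh.2 (by simp [hbc.symm, hab])
      · exact hh.1
      · exact absurd hh.2 (by simp [hab, hac])
    obtain ⟨s, hs1, hs2⟩ := h.exists_common hadj hadj' hbc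
    rw [ht, Sym2.mem_iff] at hs1
    have hsq : s ≠ q := by
      rintro rfl
      rcases hs1 with h1 | h1
      · exact hpq h1.symm
      · exact htq h1.symm
    have heq := (Sym2.mem_and_mem_iff hsq).1 ⟨hs2, hq⟩
    rcases hs1 with rfl | rfl
    · have := h.injOn (x₁ := s(a, c)) (x₂ := s(x, a)) hadj' ha (by rw [heq, hφa])
      simp [hxc.symm, hxa.symm] at this
    · have := h.mem s(a, c) hadj'
      rw [heq] at this
      exact this.symm
  have hrt : G.Adj b c → G'.Adj r t := by
    intro hadj'
    have hr : r ∈ φ s(b, c) := by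
      rcases hedge (e := s(b, c)) hadj' (by simp; tauto) (by simp; tauto) (by simp; tauto) (by simp)
        with hh | hh | hh
      · exact absurd hh.2 (by simp [hac.symm, hab.symm, hbc.symm])
      · exact absurd hh.2 (by simp [hab.symm, hbc])
      · exact hh.1
    obtain ⟨s, hs1, hs2⟩ := h.exists_common hadj.symm hadj' hac
    rw [Sym2.eq_swap, ht, Sym2.mem_iff] at hs1
    have hsr : s ≠ r := by
      rintro rfl
      rcases hs1 with h1 | h1
      · exact hpr h1.symm
      · exact htr h1.symm
    have heq := (Sym2.mem_and_mem_iff hsr).1 ⟨hs2, hr⟩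
    rcases hs1 with rfl | rfl
    · have := h.injOn (x₁ := s(b, c)) (x₂ := s(x, b)) hadj' hb (by rw [heq, hφb])
      simp [hxc.symm, hxb.symm] at this
    · have := h.mem s(b, c) hadj'
      rw [heq] at this
      exact this.symm
  have hpt' := hpt.ne
  let f : V → W := fun u => if u = x then p else if u = a then q else if u = b then r else t
  have fx : f x = p := by simp [f]
  have fa : f a = q := by simp [f, hxa.symm]
  have fb : f b = r := by simp [f, hxb.symm, hab.symm]
  have fc : f c = t := by simp [f, hxc.symm, hac.symm, hbc.symm]
  refine ⟨f, fun u w huw => ?_, fun u w huw => ?_⟩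
  · rcases hall u with rfl | rfl | rfl | rfl <;> rcases hall w with rfl | rfl | rfl | rfl <;>
      first
      | rfl
      | (simp only [fx, fa, fb, fc] at huw; exact absurd huw (by first | assumption | (apply Ne.symm; assumption)))
  · rcases hall u with rfl | rfl | rfl | rfl <;> rcases hall w with rfl | rfl | rfl | rfl <;>
      simp only [fx, fa, fb, fc] <;>
      first
      | exact absurd rfl huw.ne
      | assumption
      | (apply SimpleGraph.Adj.symm; assumption)
      | exact hqt huw
      | exact hrt huw
      | exact (hqt huw.symm).symm
      | exact (hrt huw.symm).symm

/-- Whitney's theorem when some claw is mapped to a triangle. -/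
theorem exists_injective_or_claw (h : IncidencePreserving G G' φ)
    (hG : G.Preconnected) {x a b c : V}
    (ha : G.Adj x a) (hb : G.Adj x b) (hc : G.Adj x c) (hab : a ≠ b) (hac : a ≠ c) (hbc : b ≠ c)
    {p q r : W} (hpq : p ≠ q) (hpr : p ≠ r) (hqr : q ≠ r) (hφa : φ s(x, a) = s(p, q))
    (hφb : φ s(x, b) = s(p, r)) (hφc : φ s(x, c) = s(q, r)) :
    (∃ f : V → W, Function.Injective f ∧ ∀ u w, G.Adj u w → G'.Adj (f u) (f w)) ∨
    G ≤ SimpleGraph.edge x a ⊔ SimpleGraph.edge x b ⊔ SimpleGraph.edge x c := by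
  by_cases h1 : G.Adj a b
  · exact Or.inl (h.exists_injective_of_claw_to_triangle_of_adj hG ha hb hc hab hac hbc hpq hpr hqr
      hφa hφb hφc h1)
  by_cases h2 : G.Adj a c
  · exact Or.inl (h.exists_injective_of_claw_to_triangle_of_adj hG ha hc hb hac hab hbc.symm
      hpq.symm hqr hpr (by rw [hφa, Sym2.eq_swap]) hφc hφb h2)
  by_cases h3 : G.Adj b c
  · exact Or.inl (h.exists_injective_of_claw_to_triangle_of_adj hG hb hc ha hbc hab.symm hac.symm
      hpr.symm hqr.symm hpq (by rw [hφb, Sym2.eq_swap]) (by rw [hφc, Sym2.eq_swap]) hφa h3)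
  -- With no two leaves adjacent, no further edge can touch the claw, so the claw is all of G.
  right
  have hedge : ∀ u w, G.Adj u w → (u = x ∨ u = a ∨ u = b ∨ u = c) →
      s(u, w) = s(x, a) ∨ s(u, w) = s(x, b) ∨ s(u, w) = s(x, c) := by
    intro u w huw hu
    by_contra! hcon
    have := h.edge_of_claw_to_triangle ha hb hc hab hac hbc hpq hpr hqr hφa hφb hφc (e := s(u, w))
      huw hcon.1 hcon.2.1 hcon.2.2 (by rcases hu with rfl | rfl | rfl | rfl <;> simp)
    rcases this with hh | hh | hh
    · exact h1 (by have := hh.2 ▸ (G.mem_edgeSet.2 huw); exact this)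
    · exact h2 (by have := hh.2 ▸ (G.mem_edgeSet.2 huw); exact this)
    · exact h3 (by have := hh.2 ▸ (G.mem_edgeSet.2 huw); exact this)
  have hall : ∀ u, u = x ∨ u = a ∨ u = b ∨ u = c := by
    refine hG.mem_of_closed (S := {u | u = x ∨ u = a ∨ u = b ∨ u = c}) (a := x) (Or.inl rfl) ?_
    intro u w hu huw
    have := hedge u w huw hu
    simp only [Sym2.eq_iff] at this
    simp only [Set.mem_ofPred_eq]
    tauto
  intro u w huw
  have hne := huw.ne
  simp only [SimpleGraph.sup_adj, SimpleGraph.adj_edge]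
  rcases hedge u w huw (hall u) with hh | hh | hh <;> simp [hh.symm, hne]

/-- Whitney's theorem when no claw is mapped to a triangle. -/
theorem exists_injective_or_triangle (h : IncidencePreserving G G' φ) (hG : G.Preconnected)
    (hstar : ∀ x a b c, G.Adj x a → G.Adj x b → G.Adj x c → a ≠ b → a ≠ c → b ≠ c →
      ∃ p, p ∈ φ s(x, a) ∧ p ∈ φ s(x, b) ∧ p ∈ φ s(x, c)) {x₀ y₀ : V} (h₀ : G.Adj x₀ y₀) :
    (∃ f : V → W, Function.Injective f ∧ ∀ u w, G.Adj u w → G'.Adj (f u) (f w)) ∨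
    ∃ x y z p, G.Adj x y ∧ G.Adj x z ∧ G.Adj y z ∧ (∀ u, u = x ∨ u = y ∨ u = z) ∧
      p ∈ φ s(x, y) ∧ p ∈ φ s(x, z) ∧ p ∈ φ s(y, z) := by
  classical
  have hnbr : ∀ u, ∃ w, G.Adj u w := by
    intro u
    by_contra! hcon
    have : ∀ w, w ∈ ({u} : Set V) := hG.mem_of_closed (a := u) rfl (by
      rintro a b rfl hab; exact absurd hab (hcon b))
    have h1 : x₀ = u := this x₀
    subst h1
    exact hcon _ h₀
  let two : V → Prop := fun u => ∃ a b, a ≠ b ∧ G.Adj u a ∧ G.Adj u b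
  have huniq : ∀ u, ¬ two u → ∀ a b, G.Adj u a → G.Adj u b → a = b := by
    intro u hu a b ha hb
    by_contra hab
    exact hu ⟨a, b, hab, ha, hb⟩
  by_cases hone : ∃ u w, G.Adj u w ∧ ¬ two u ∧ ¬ two w
  · left
    obtain ⟨u, w, huw, hu, hw⟩ := hone
    have hall : ∀ t, t ∈ ({u, w} : Set V) := hG.mem_of_closed (a := u) (by simp) (by
      rintro a b (rfl | rfl) hab
      · right; exact huniq _ hu _ _ hab huw
      · left; exact huniq _ hw _ _ hab huw.symm)
    have hall' : ∀ t, t = u ∨ t = w := hall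
    obtain ⟨p, q, hpq⟩ : ∃ p q, φ s(u, w) = s(p, q) := by
      induction hφ : φ s(u, w) with | _ p q => exact ⟨p, q, rfl⟩
    have hadj : G'.Adj p q := by
      have := h.mem s(u, w) huw
      rwa [hpq] at this
    have hne := huw.ne
    let f : V → W := fun t => if t = u then p else q
    have fu : f u = p := by simp [f]
    have fw : f w = q := by simp [f, hne.symm]
    refine ⟨f, fun s t hst => ?_, fun s t hst => ?_⟩
    · rcases hall' s with rfl | rfl <;> rcases hall' t with rfl | rfl
      · rfl
      · rw [fu, fw] at hst; exact absurd hst hadj.ne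
      · rw [fu, fw] at hst; exact absurd hst hadj.ne'
      · rfl
    · rcases hall' s with rfl | rfl <;> rcases hall' t with rfl | rfl
      · exact absurd rfl hst.ne
      · rwa [fu, fw]
      · rw [fu, fw]; exact hadj.symm
      · exact absurd rfl hst.ne
  push Not at hone
  -- The images of all edges at a vertex of degree at least two share a vertex, which any two of
  -- them determine. At other vertices the value is arbitrary.
  have hcentre : ∀ u, ∃ p, two u → ∀ w, G.Adj u w → p ∈ φ s(u, w) := by
    intro u
    by_cases hu : two u
    · obtain ⟨a, b, hab, ha, hb⟩ := hu
      obtain ⟨p, hpa, hpb⟩ := h.exists_common ha hb hab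
      refine ⟨p, fun _ w hw => ?_⟩
      by_cases hwa : w = a
      · rwa [hwa]
      by_cases hwb : w = b
      · rwa [hwb]
      obtain ⟨p', h1, h2, h3⟩ := hstar u a b w ha hb hw hab (Ne.symm hwa) (Ne.symm hwb)
      rwa [h.eq_of_mem (e := s(u, a)) (f := s(u, b)) ha hb (mt Sym2.congr_right.1 hab) hpa hpb h1 h2]
    · exact ⟨(φ s(x₀, y₀)).out.1, fun h' => absurd h' hu⟩
  choose c₀ hc₀ using hcentre
  -- If adjacent u and w share a centre, the other edges at u meet the other edges at w. This forces
  -- a single third vertex s, with no further neighbours, so G is a triangle.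
  by_cases hdist : ∃ u w, G.Adj u w ∧ two u ∧ two w ∧ c₀ u = c₀ w
  · right
    obtain ⟨u, w, huw, hu, hw, heq⟩ := hdist
    have hne := huw.ne
    have hothers : ∀ s t, G.Adj u s → s ≠ w → G.Adj w t → t ≠ u → s = t := by
      intro s t hus hs hwt ht
      have hneq : s(u, s) ≠ s(w, t) := by
        rw [Ne, Sym2.eq_iff]; rintro (hh | hh)
        · exact hne hh.1
        · exact hs hh.2
      obtain ⟨z, hz1, hz2⟩ := (h.meet s(u, s) hus s(w, t) hwt hneq).1
        ⟨c₀ u, hc₀ u hu s hus, heq ▸ hc₀ w hw t hwt⟩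
      rw [Sym2.mem_iff] at hz1 hz2
      rcases hz1 with rfl | rfl <;> rcases hz2 with hh | hh
      · exact absurd hh hne
      · exact absurd hh.symm ht
      · exact absurd hh hs
      · exact hh
    obtain ⟨s, hus, hsw⟩ : ∃ s, G.Adj u s ∧ s ≠ w := by
      obtain ⟨a, b, hab, ha, hb⟩ := hu
      by_cases haw : a = w
      · exact ⟨b, hb, by rintro rfl; exact hab haw⟩
      · exact ⟨a, ha, haw⟩
    obtain ⟨t, hwt, htu⟩ : ∃ t, G.Adj w t ∧ t ≠ u := by
      obtain ⟨a, b, hab, ha, hb⟩ := hw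
      by_cases haw : a = u
      · exact ⟨b, hb, by rintro rfl; exact hab haw⟩
      · exact ⟨a, ha, haw⟩
    obtain rfl := hothers s t hus hsw hwt htu
    have hus' := hus.symm
    have hws' := hwt.symm
    have hpus := hc₀ u hu s hus
    have hpws := hc₀ w hw s hwt
    have hpuw := hc₀ u hu w huw
    rw [← heq] at hpws
    have hsnbr : ∀ z, G.Adj s z → z = u ∨ z = w := by
      intro z hz
      by_contra! hcon
      obtain ⟨p', h1, h2, h3⟩ := hstar s u w z hus' hws' hz hne (Ne.symm hcon.1) (Ne.symm hcon.2)
      have hp' : p' = c₀ u := h.eq_of_mem (e := s(s, u)) (f := s(s, w)) hus' hws' (mt Sym2.congr_right.1 hne)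
        h1 h2 (by rwa [Sym2.eq_swap]) (by rwa [Sym2.eq_swap])
      rw [hp'] at h3
      obtain ⟨y, hy1, hy2⟩ := (h.meet s(s, z) hz s(u, w) huw (by
        rw [Ne, Sym2.eq_iff]; rintro (hh | hh)
        · exact htu hh.1
        · exact hsw hh.1)).1 ⟨c₀ u, h3, hpuw⟩
      rw [Sym2.mem_iff] at hy1 hy2
      rcases hy1 with rfl | rfl <;> rcases hy2 with hh | hh
      · exact htu hh
      · exact hsw hh
      · exact hcon.1 hh
      · exact hcon.2 hh
    refine ⟨u, w, s, c₀ u, huw, hus, hwt, ?_, hpuw, hpus, hpws⟩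
    refine hG.mem_of_closed (S := {z | z = u ∨ z = w ∨ z = s}) (a := u) (Or.inl rfl) ?_
    rintro a b (rfl | rfl | rfl) hab
    · by_cases hb : b = w
      · exact Or.inr (Or.inl hb)
      · exact Or.inr (Or.inr (hothers b s hab hb hwt htu))
    · by_cases hb : b = u
      · exact Or.inl hb
      · exact Or.inr (Or.inr (hothers s b hus hsw hab hb).symm)
    · rcases hsnbr b hab with hb | hb
      · exact Or.inl hb
      · exact Or.inr (Or.inl hb)
  push Not at hdist
  left
  -- A leaf is sent to the end of its edge's image other than its neighbour's centre.
  have hleaf : ∀ u, ∃ q, (two u → q = c₀ u) ∧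
      (¬ two u → ∀ w, G.Adj u w → φ s(u, w) = s(c₀ w, q)) := by
    intro u
    by_cases hu : two u
    · exact ⟨c₀ u, fun _ => rfl, fun h' => absurd hu h'⟩
    · obtain ⟨w, hw⟩ := hnbr u
      have hw2 : two w := hone u w hw hu
      have hmem := hc₀ w hw2 u hw.symm
      obtain ⟨q, hq⟩ := hmem
      refine ⟨q, fun h' => absurd h' hu, fun _ w' hw' => ?_⟩
      rw [huniq u hu w' w hw' hw, Sym2.eq_swap, hq]
  choose c hc1 hc2 using hleaf
  have hφ : ∀ u w, G.Adj u w → φ s(u, w) = s(c u, c w) := by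
    intro u w huw
    by_cases hu : two u <;> by_cases hw : two w
    · rw [hc1 u hu, hc1 w hw]
      refine (Sym2.mem_and_mem_iff (hdist u w huw hu hw)).1 ⟨hc₀ u hu w huw, ?_⟩
      rw [Sym2.eq_swap]
      exact hc₀ w hw u huw.symm
    · rw [Sym2.eq_swap, hc2 w hw u huw.symm, hc1 u hu]
    · rw [hc2 u hu w huw, hc1 w hw, Sym2.eq_swap]
    · exact absurd (hone u w huw hu) hw
  have hcadj : ∀ u w, G.Adj u w → G'.Adj (c u) (c w) := by
    intro u w huw
    have := h.mem s(u, w) huw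
    rwa [hφ u w huw] at this
  refine ⟨c, fun u w huw => ?_, hcadj⟩
  -- If c u = c w, then edges at u and at w have meeting images, so u and w have a common neighbour
  -- a; then φ(ua) = φ(wa), against injectivity.
  by_contra hne
  obtain ⟨a, ha⟩ := hnbr u
  obtain ⟨b, hb⟩ := hnbr w
  have hnadj : ¬ G.Adj u w := fun hh => (hcadj u w hh).ne huw
  have hab : a = b := by
    by_cases heq : s(u, a) = s(w, b)
    · rw [Sym2.eq_iff] at heq
      rcases heq with hh | hh
      · exact absurd hh.1 hne
      · exact absurd (hh.2 ▸ ha) hnadj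
    obtain ⟨z, hz1, hz2⟩ := (h.meet s(u, a) ha s(w, b) hb heq).1
      ⟨c u, by rw [hφ u a ha]; simp, by rw [hφ w b hb, huw]; simp⟩
    rw [Sym2.mem_iff] at hz1 hz2
    rcases hz1 with rfl | rfl <;> rcases hz2 with hh | hh
    · exact absurd hh hne
    · exact absurd (hh ▸ hb).symm hnadj
    · exact absurd (hh ▸ ha) hnadj
    · exact hh
  subst hab
  have := h.injOn (x₁ := s(u, a)) (x₂ := s(w, a)) ha hb (by rw [hφ u a ha, hφ w a hb, huw])
  rw [Sym2.eq_iff] at this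
  rcases this with hh | hh
  · exact hne hh.1
  · exact hne (hh.1.trans hh.2)

end IncidencePreserving

end Whitney


/-! ### Comparing spectral radii of graphs with nearly isomorphic line graphs. -/

section NormComparison

variable {V : Type u} {W : Type v}

theorem graphNorm_bot [Finite V] : graphNorm (⊥ : SimpleGraph V) = 0 := by
  cases nonempty_fintype V
  exact le_antisymm (graphNorm_le_of_adjForm_le _ le_rfl fun x _ => by simp [adjForm])
    (graphNorm_nonneg _)

/-- A graph whose edges all lie in a claw has spectral radius at most two. -/
theorem graphNorm_le_two_of_edges_in_claw [Finite V] {F : SimpleGraph V} {x a b c : V}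
    (hxa : x ≠ a) (hxb : x ≠ b) (hxc : x ≠ c) (hab : a ≠ b) (hac : a ≠ c) (hbc : b ≠ c)
    (h : F ≤ SimpleGraph.edge x a ⊔ SimpleGraph.edge x b ⊔ SimpleGraph.edge x c) :
    graphNorm F ≤ 2 := by
  classical
  cases nonempty_fintype V
  refine graphNorm_le_of_adjForm_le _ (by norm_num) fun v hv => ?_
  have h0 := adjForm_mono h hv
  have h1 := adjForm_sup_edge_le (SimpleGraph.edge x a ⊔ SimpleGraph.edge x b) x c hv
  have h2 := adjForm_sup_edge_le (SimpleGraph.edge x a) x b hv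
  have h3 := adjForm_sup_edge_le (⊥ : SimpleGraph V) x a hv
  rw [bot_sup_eq] at h3
  have h4 : adjForm (⊥ : SimpleGraph V) v = 0 := by simp [adjForm]
  have h5 : v x ^ 2 + (v a ^ 2 + (v b ^ 2 + v c ^ 2)) ≤ ∑ u, v u ^ 2 := by
    have : ∑ u ∈ {x, a, b, c}, v u ^ 2 ≤ ∑ u, v u ^ 2 :=
      sum_le_sum_of_subset_of_nonneg (subset_univ _) fun _ _ _ => sq_nonneg _
    rwa [sum_insert (by simp [hxa, hxb, hxc]), sum_insert (by simp [hab, hac]),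
      sum_pair hbc] at this
  have h6 : 2 * (v x * (v a + v b + v c)) ≤ 2 * v x ^ 2 + (v a + v b + v c) ^ 2 / 2 := by
    nlinarith [sq_nonneg (2 * v x - (v a + v b + v c))]
  nlinarith [sq_nonneg (v a - v b), sq_nonneg (v a - v c), sq_nonneg (v b - v c), sq_nonneg (v a),
    sq_nonneg (v b), sq_nonneg (v c)]

/-- A graph containing a triangle has spectral radius at least two. -/
theorem two_le_graphNorm_of_triangle [Finite V] {F : SimpleGraph V} {p q r : V}
    (hpq : F.Adj p q) (hpr : F.Adj p r) (hqr : F.Adj q r) : 2 ≤ graphNorm F := by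
  classical
  have hK : 2 ≤ graphNorm (⊤ : SimpleGraph (Fin 3)) := by
    have h := adjForm_le (⊤ : SimpleGraph (Fin 3)) ![1, 1, 1]
    simp [adjForm, Fin.sum_univ_three] at h
    linarith
  refine hK.trans (graphNorm_le_of_injective_hom ![p, q, r] ?_ ?_)
  · intro i j
    have := hpq.ne; have := hpr.ne; have := hqr.ne
    fin_cases i <;> fin_cases j <;> simp_all [eq_comm]
  · intro i j hij
    have := hpq.symm; have := hpr.symm; have := hqr.symm
    fin_cases i <;> fin_cases j <;> simp_all

/-- An isolated triangle of `G` whose edges are sent by `φ` to edges with a common end `p`. -/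
structure IsolatedTriangleToClaw (G : SimpleGraph V) (φ : Sym2 V → Sym2 W) (x y z : V) (p : W) :
    Prop where
  adj_xy : G.Adj x y
  adj_xz : G.Adj x z
  adj_yz : G.Adj y z
  nbr_x : ∀ u, G.Adj x u → u = y ∨ u = z
  nbr_y : ∀ u, G.Adj y u → u = x ∨ u = z
  nbr_z : ∀ u, G.Adj z u → u = x ∨ u = y
  mem_xy : p ∈ φ s(x, y)
  mem_xz : p ∈ φ s(x, z)
  mem_yz : p ∈ φ s(y, z)

namespace IncidencePreserving

variable {G : SimpleGraph V} {G' : SimpleGraph W} {φ : Sym2 V → Sym2 W}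

/-- A claw sent to a triangle costs nothing, since 2 separates their radii. Only the opposite
exception survives. -/
theorem graphNorm_le_of_connected [Finite V] [Finite W] (h : IncidencePreserving G G' φ)
    (hG : G.Connected) : graphNorm G ≤ graphNorm G' ∨
      ∃ x y z p, IsolatedTriangleToClaw G φ x y z p ∧ graphNorm G ≤ 2 := by
  by_cases hne : G = ⊥
  · left
    rw [hne, graphNorm_bot]
    exact graphNorm_nonneg G'
  obtain ⟨x₀, y₀, h₀⟩ := SimpleGraph.ne_bot_iff_exists_adj.1 hne
  by_cases hstar : ∀ x a b c, G.Adj x a → G.Adj x b → G.Adj x c → a ≠ b → a ≠ c → b ≠ c →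
      ∃ p, p ∈ φ s(x, a) ∧ p ∈ φ s(x, b) ∧ p ∈ φ s(x, c)
  · rcases h.exists_injective_or_triangle hG.preconnected hstar h₀ with
      ⟨f, hf, hadj⟩ | ⟨x, y, z, p, hxy, hxz, hyz, hall, h1, h2, h3⟩
    · exact Or.inl (graphNorm_le_of_injective_hom f hf hadj)
    · right
      have nx : ∀ u, G.Adj x u → u = y ∨ u = z := fun u hu => (hall u).resolve_left hu.ne'
      have ny : ∀ u, G.Adj y u → u = x ∨ u = z := fun u hu => by
        have := hall u; have := hu.ne'; tauto
      have nz : ∀ u, G.Adj z u → u = x ∨ u = y := fun u hu => by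
        have := hall u; have := hu.ne'; tauto
      refine ⟨x, y, z, p, ⟨hxy, hxz, hyz, nx, ny, nz, h1, h2, h3⟩, ?_⟩
      refine graphNorm_le_two_of_edges_in_triangle hxy.ne hxz.ne hyz.ne fun u w huw => ?_
      have hne := huw.ne
      simp only [SimpleGraph.sup_adj, SimpleGraph.edge_adj]
      rcases hall u with rfl | rfl | rfl
      · rcases nx w huw with rfl | rfl <;> simp [hne]
      · rcases ny w huw with rfl | rfl <;> simp [hne]
      · rcases nz w huw with rfl | rfl <;> simp [hne]
  · left
    push Not at hstar
    obtain ⟨x, a, b, c, ha, hb, hc, hab, hac, hbc, hno⟩ := hstar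
    rcases h.common_or_triangle ha hb hc hab hac hbc with
      ⟨p, h1, h2, h3⟩ | ⟨p, q, r, hpq, hpr, hqr, hφa, hφb, hφc⟩
    · exact absurd h3 (hno p h1 h2)
    rcases h.exists_injective_or_claw hG.preconnected ha hb hc hab hac hbc hpq hpr hqr
      hφa hφb hφc with ⟨f, hf, hadj⟩ | hle
    · exact graphNorm_le_of_injective_hom f hf hadj
    · refine (graphNorm_le_two_of_edges_in_claw ha.ne hb.ne hc.ne hab hac hbc hle).trans ?_
      have ma := h.mem s(x, a) ha
      have mb := h.mem s(x, b) hb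
      have mc := h.mem s(x, c) hc
      rw [hφa] at ma
      rw [hφb] at mb
      rw [hφc] at mc
      exact two_le_graphNorm_of_triangle ma mb mc

theorem graphNorm_le [Finite V] [Finite W] (h : IncidencePreserving G G' φ) :
    graphNorm G ≤ graphNorm G' ∨
      ∃ x y z p, IsolatedTriangleToClaw G φ x y z p ∧ graphNorm G ≤ 2 := by
  cases isEmpty_or_nonempty V
  · left
    rw [graphNorm_of_isEmpty]
    exact graphNorm_nonneg G'
  obtain ⟨C, hC⟩ := exists_component_graphNorm_le G
  have hmem : ∀ e ∈ C.toSimpleGraph.edgeSet, e.map Subtype.val ∈ G.edgeSet := by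
    intro e he
    induction e with | _ u w => exact C.toSimpleGraph_hom.map_adj he
  have hinj := Sym2.map.injective (Subtype.val_injective (p := (· ∈ C.supp)))
  have h' : IncidencePreserving C.toSimpleGraph G' (fun e => φ (e.map Subtype.val)) := by
    refine ⟨fun e he => h.mem _ (hmem e he), fun e he f hf hef => ?_, fun e he f hf hef => ?_⟩
    · exact hinj (h.injOn (hmem e he) (hmem f hf) hef)
    · rw [h.meet _ (hmem e he) _ (hmem f hf) (hinj.ne hef)]
      constructor
      · rintro ⟨x, hx1, hx2⟩
        obtain ⟨u, hu, rfl⟩ := Sym2.mem_map.1 hx1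
        obtain ⟨w, hw, hwu⟩ := Sym2.mem_map.1 hx2
        rw [Subtype.val_injective hwu] at hw
        exact ⟨u, hu, hw⟩
      · rintro ⟨x, hx1, hx2⟩
        exact ⟨x, Sym2.mem_map.2 ⟨x, hx1, rfl⟩, Sym2.mem_map.2 ⟨x, hx2, rfl⟩⟩
  rcases h'.graphNorm_le_of_connected C.connected_toSimpleGraph with hle | ⟨x, y, z, p, ht, h2⟩
  · exact Or.inl (hC.trans hle)
  · right
    have nbr : ∀ (s t r : C), (∀ u, C.toSimpleGraph.Adj s u → u = t ∨ u = r) →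
        ∀ u, G.Adj s u → u = t ∨ u = r := by
      intro s t r hs u hu
      have hmem : u ∈ C.supp := C.mem_supp_of_adj_mem_supp s.2 hu
      rcases hs ⟨u, hmem⟩ hu with hh | hh
      · exact Or.inl (congrArg Subtype.val hh)
      · exact Or.inr (congrArg Subtype.val hh)
    exact ⟨x, y, z, p, ⟨ht.adj_xy, ht.adj_xz, ht.adj_yz, nbr _ _ _ ht.nbr_x, nbr _ _ _ ht.nbr_y,
      nbr _ _ _ ht.nbr_z, ht.mem_xy, ht.mem_xz, ht.mem_yz⟩, hC.trans h2⟩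

theorem sqrt_three_le_graphNorm [Finite W] (h : IncidencePreserving G G' φ) {x y z : V} {p : W}
    (ht : IsolatedTriangleToClaw G φ x y z p) : √3 ≤ graphNorm G' := by
  obtain ⟨q, hq⟩ := ht.mem_xy
  obtain ⟨r, hr⟩ := ht.mem_xz
  obtain ⟨s, hs⟩ := ht.mem_yz
  have mq := h.mem s(x, y) ht.adj_xy
  have mr := h.mem s(x, z) ht.adj_xz
  have ms := h.mem s(y, z) ht.adj_yz
  have hxy := ht.adj_xy.ne
  have hxz := ht.adj_xz.ne
  have hyz := ht.adj_yz.ne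
  have n1 : s(x, y) ≠ s(x, z) := mt Sym2.congr_right.1 hyz
  have n2 : s(x, y) ≠ s(y, z) := by
    rw [Sym2.eq_swap]; exact mt Sym2.congr_right.1 hxz
  have n3 : s(x, z) ≠ s(y, z) := mt Sym2.congr_left.1 hxy
  refine sqrt_three_le_graphNorm_of_claw (p := p) (q := q) (r := r) (s := s) ?_ ?_ ?_ ?_ ?_ ?_
  · rwa [hq] at mq
  · rwa [hr] at mr
  · rwa [hs] at ms
  · rintro rfl
    exact n1 (h.injOn ht.adj_xy ht.adj_xz (hq.trans hr.symm))
  · rintro rfl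
    exact n2 (h.injOn ht.adj_xy ht.adj_yz (hq.trans hs.symm))
  · rintro rfl
    exact n3 (h.injOn ht.adj_xz ht.adj_yz (hr.trans hs.symm))

theorem graphNorm_le_add [Finite V] [Finite W] (h : IncidencePreserving G G' φ) :
    graphNorm G ≤ graphNorm G' + (2 - √3) := by
  have hs3 : √(3:ℝ) ≤ 2 := by
    rw [Real.sqrt_le_left (by norm_num)]; norm_num
  rcases h.graphNorm_le with hle | ⟨x, y, z, p, ht, h2⟩
  · linarith
  · have := h.sqrt_three_le_graphNorm ht
    linarith

end IncidencePreserving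

/-- A correspondence of edges that respects adjacency away from a set of edges yields an
incidence preserving map after deleting these edges. -/
theorem exists_incidencePreserving_deleteEdges {G : SimpleGraph V} {G' : SimpleGraph W}
    (ψ : G.edgeSet → G'.edgeSet) (hψ : Function.Injective ψ) (S : Set G.edgeSet)
    (hadj : ∀ e f, e ∉ S → f ∉ S → (G.lineGraph.Adj e f ↔ G'.lineGraph.Adj (ψ e) (ψ f)))
    (p₀ : W) : ∃ φ : Sym2 V → Sym2 W,
      IncidencePreserving (G.deleteEdges (Subtype.val '' S))
        (G'.deleteEdges (Subtype.val '' (ψ '' S))) φ := by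
  classical
  -- The value off the edges of G is never used.
  refine ⟨fun e => if h : e ∈ G.edgeSet then (ψ ⟨e, h⟩).1 else s(p₀, p₀), ?_, ?_, ?_⟩
  · intro e he
    rw [SimpleGraph.edgeSet_deleteEdges] at he ⊢
    have h1 := he.1
    simp only [h1, dif_pos]
    refine ⟨(ψ ⟨e, h1⟩).2, ?_⟩
    rintro ⟨_, ⟨f, hf, rfl⟩, hfe⟩
    have := hψ (Subtype.val_injective hfe)
    exact he.2 ⟨f, hf, by rw [this]⟩
  · intro e he f hf hef
    rw [SimpleGraph.edgeSet_deleteEdges] at he hf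
    simp only [he.1, hf.1, dif_pos] at hef
    exact congrArg Subtype.val (hψ (Subtype.val_injective hef))
  · intro e he f hf hef
    rw [SimpleGraph.edgeSet_deleteEdges] at he hf
    simp only [he.1, hf.1, dif_pos]
    have h1 := hadj ⟨e, he.1⟩ ⟨f, hf.1⟩ (fun hh => he.2 ⟨_, hh, rfl⟩) (fun hh => hf.2 ⟨_, hh, rfl⟩)
    rw [SimpleGraph.lineGraph_adj_iff_exists, SimpleGraph.lineGraph_adj_iff_exists] at h1
    have h2 : (⟨e, he.1⟩ : G.edgeSet) ≠ ⟨f, hf.1⟩ := fun hh => hef (congrArg Subtype.val hh)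
    have h3 := hψ.ne h2
    simpa [h2, h3] using h1.symm

theorem SimpleGraph.Connected.preconnected_lineGraph {G : SimpleGraph V} (hG : G.Connected) :
    G.lineGraph.Preconnected := by
  intro e f
  have step : ∀ (g k : G.edgeSet) (u : V), u ∈ g.1 → u ∈ k.1 → G.lineGraph.Reachable g k := by
    intro g k u hg hk
    by_cases hgk : g = k
    · rw [hgk]
    · exact (SimpleGraph.lineGraph_adj_iff_exists.2 ⟨hgk, u, hg, hk⟩).reachable
  obtain ⟨u₀, hu₀⟩ : ∃ u, u ∈ e.1 := ⟨_, Sym2.out_fst_mem e.1⟩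
  obtain ⟨w₀, hw₀⟩ : ∃ u, u ∈ f.1 := ⟨_, Sym2.out_fst_mem f.1⟩
  refine hG.preconnected.mem_of_closed (S := {u | ∀ g : G.edgeSet, u ∈ g.1 →
    G.lineGraph.Reachable e g}) (a := u₀) (fun g hg => step e g u₀ hu₀ hg) ?_ w₀ f hw₀
  intro u w hu huw g hg
  exact (hu ⟨s(u, w), huw⟩ (by simp)).trans (step _ g w (by simp) hg)

theorem le_deleteEdges_sup_edge (G : SimpleGraph V) {u w : V} {S : Set (Sym2 V)}
    (hS : S ⊆ {s(u, w)}) : G ≤ G.deleteEdges S ⊔ SimpleGraph.edge u w := by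
  intro a b hab
  by_cases h : s(a, b) ∈ S
  · right
    rw [SimpleGraph.adj_edge]
    exact ⟨(hS h).symm, hab.ne⟩
  · left
    rw [SimpleGraph.deleteEdges_adj]
    exact ⟨hab, h⟩

/-- Edges of an isolated triangle form a set closed under adjacency of edges. -/
theorem IsolatedTriangleToClaw.mem_of_meet {G : SimpleGraph V} {φ : Sym2 V → Sym2 W} {x y z : V}
    {p : W} (ht : IsolatedTriangleToClaw G φ x y z p) {e f : Sym2 V}
    (he : e ∈ ({s(x, y), s(x, z), s(y, z)} : Set (Sym2 V))) (hf : f ∈ G.edgeSet) {u : V}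
    (hue : u ∈ e) (huf : u ∈ f) : f ∈ ({s(x, y), s(x, z), s(y, z)} : Set (Sym2 V)) := by
  have hu : u = x ∨ u = y ∨ u = z := by
    rcases he with rfl | rfl | rfl <;> rw [Sym2.mem_iff] at hue <;> tauto
  obtain ⟨w, rfl⟩ := huf
  rcases hu with rfl | rfl | rfl
  · rcases ht.nbr_x w hf with rfl | rfl <;> simp
  · rcases ht.nbr_y w hf with rfl | rfl <;> simp
  · rcases ht.nbr_z w hf with rfl | rfl <;> simp

/-- `hattach` says that a is adjacent to every component of L(G) - a. It is needed when deleting a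
leaves an isolated triangle sent to a claw, where adding 1 to the loss 2 - √3 would be too much. -/
theorem graphNorm_le_add_one_of_adj_iff_off_edge [Finite V] [Finite W] {G : SimpleGraph V}
    {G' : SimpleGraph W} (ψ : G.edgeSet → G'.edgeSet) (hψ : Function.Injective ψ) (a : G.edgeSet)
    (hadj : ∀ e f, e ≠ a → f ≠ a → (G.lineGraph.Adj e f ↔ G'.lineGraph.Adj (ψ e) (ψ f)))
    (hattach : ∀ S : Set G.edgeSet, S.Nonempty → a ∉ S →
      (∀ e f, e ∈ S → f ≠ a → G.lineGraph.Adj e f → f ∈ S) → ∃ e ∈ S, G.lineGraph.Adj e a) :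
    graphNorm G ≤ graphNorm G' + 1 := by
  obtain ⟨φ, h⟩ := exists_incidencePreserving_deleteEdges ψ hψ {a} hadj (Quot.out (ψ a).1).1
  have hK' : graphNorm (G'.deleteEdges (Subtype.val '' (ψ '' {a}))) ≤ graphNorm G' :=
    graphNorm_mono (G'.deleteEdges_le _)
  rw [Set.image_singleton] at h
  set K := G.deleteEdges {a.1} with hKdef
  have hdel : ∀ u w, a.1 = s(u, w) → G ≤ K ⊔ SimpleGraph.edge u w := by
    intro u w ha
    exact le_deleteEdges_sup_edge G (by rw [ha])
  rcases h.graphNorm_le with hle | ⟨x, y, z, p, ht, h2⟩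
  · obtain ⟨u, w, huw⟩ : ∃ u w, a.1 = s(u, w) := by
      obtain ⟨w, hw⟩ := Sym2.out_fst_mem a.1
      exact ⟨_, w, hw⟩
    have h1 := graphNorm_mono (hdel u w huw)
    have h2 := graphNorm_sup_edge_le K u w
    linarith
  · have hs := h.sqrt_three_le_graphNorm ht
    have hKG : ∀ e ∈ K.edgeSet, e ∈ G.edgeSet := by
      intro e he
      rw [hKdef, SimpleGraph.edgeSet_deleteEdges] at he
      exact he.1
    have hmemK : ∀ e ∈ ({s(x, y), s(x, z), s(y, z)} : Set (Sym2 V)), e ∈ K.edgeSet := by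
      rintro e (rfl | rfl | rfl)
      exacts [ht.adj_xy, ht.adj_xz, ht.adj_yz]
    have haK : a.1 ∉ K.edgeSet := by
      rw [hKdef, SimpleGraph.edgeSet_deleteEdges]
      exact fun hh => hh.2 rfl
    -- The three triangle edges are closed under adjacency away from a, so a meets the triangle;
    -- restoring it gives radius at most 1 + √3, while G' contains a claw.
    obtain ⟨e, he, hea⟩ := hattach
      {e | e.1 ∈ ({s(x, y), s(x, z), s(y, z)} : Set (Sym2 V))}
      ⟨⟨s(x, y), hKG _ ht.adj_xy⟩, by simp⟩ (fun hh => haK (hmemK _ hh)) (by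
        intro e f he hf hef
        obtain ⟨-, u, hu1, hu2⟩ := SimpleGraph.lineGraph_adj_iff_exists.1 hef
        refine ht.mem_of_meet (e := e.1) (f := f.1) he ?_ hu1 hu2
        rw [hKdef, SimpleGraph.edgeSet_deleteEdges]
        exact ⟨f.2, fun hh => hf (Subtype.val_injective hh)⟩)
    obtain ⟨-, u, hu1, hu2⟩ := SimpleGraph.lineGraph_adj_iff_exists.1 hea
    have hu : u = x ∨ u = y ∨ u = z := by
      rcases he with he | he | he <;> rw [he, Sym2.mem_iff] at hu1 <;> tauto
    obtain ⟨w, hw⟩ := hu2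
    have hle := graphNorm_mono (hdel u w hw)
    have hxy := ht.adj_xy
    have hxz := ht.adj_xz
    have hyz := ht.adj_yz
    have haK' : ¬ K.Adj u w := by rwa [hw] at haK
    have huw : u ≠ w := by
      have := a.2
      rw [hw] at this
      exact SimpleGraph.Adj.ne this
    have key : graphNorm (K ⊔ SimpleGraph.edge u w) ≤ 1 + √3 := by
      rcases hu with rfl | rfl | rfl
      · exact graphNorm_sup_edge_le_of_isolated_triangle hxy.ne hxz.ne hyz.ne huw.symm
          (by rintro rfl; exact haK' hxy) (by rintro rfl; exact haK' hxz)
          ht.nbr_x ht.nbr_y ht.nbr_z h2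
      · exact graphNorm_sup_edge_le_of_isolated_triangle hxy.ne' hyz.ne hxz.ne huw.symm
          (by rintro rfl; exact haK' hxy.symm) (by rintro rfl; exact haK' hyz)
          ht.nbr_y ht.nbr_x (fun t ht' => (ht.nbr_z t ht').symm) h2
      · exact graphNorm_sup_edge_le_of_isolated_triangle hxz.ne' hyz.ne' hxy.ne huw.symm
          (by rintro rfl; exact haK' hxz.symm) (by rintro rfl; exact haK' hyz.symm)
          ht.nbr_z (fun t ht' => (ht.nbr_x t ht').symm) (fun t ht' => (ht.nbr_y t ht').symm) h2
    have hfin : √3 ≤ graphNorm G' := hs.trans (graphNorm_mono (G'.deleteEdges_le _))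
    linarith

theorem graphNorm_le_add_two_of_adj_iff_off_edges [Finite V] [Finite W] {G : SimpleGraph V}
    {G' : SimpleGraph W} (ψ : G.edgeSet → G'.edgeSet) (hψ : Function.Injective ψ)
    (a c : G.edgeSet) (hadj : ∀ e f, e ≠ a → e ≠ c → f ≠ a → f ≠ c →
      (G.lineGraph.Adj e f ↔ G'.lineGraph.Adj (ψ e) (ψ f))) :
    graphNorm G ≤ graphNorm G' + 2 := by
  obtain ⟨φ, h⟩ := exists_incidencePreserving_deleteEdges ψ hψ {a, c}
    (fun e f he hf => by
      simp only [Set.mem_insert_iff, Set.mem_singleton_iff, not_or] at he hf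
      exact hadj e f he.1 he.2 hf.1 hf.2) (Quot.out (ψ a).1).1
  have h1 := h.graphNorm_le_add
  have h2 : graphNorm (G'.deleteEdges (Subtype.val '' (ψ '' {a, c}))) ≤ graphNorm G' :=
    graphNorm_mono (G'.deleteEdges_le _)
  set K := G.deleteEdges (Subtype.val '' {a, c}) with hKdef
  obtain ⟨p, q, hpq⟩ : ∃ u w, a.1 = s(u, w) := by
    obtain ⟨w, hw⟩ := Sym2.out_fst_mem a.1
    exact ⟨_, w, hw⟩
  obtain ⟨r, s, hrs⟩ : ∃ u w, c.1 = s(u, w) := by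
    obtain ⟨w, hw⟩ := Sym2.out_fst_mem c.1
    exact ⟨_, w, hw⟩
  have hle : G ≤ K ⊔ SimpleGraph.edge p q ⊔ SimpleGraph.edge r s := by
    intro u w huw
    by_cases hm : s(u, w) ∈ Subtype.val '' ({a, c} : Set G.edgeSet)
    · obtain ⟨e, rfl | rfl, he⟩ := hm
      · left; right
        rw [SimpleGraph.adj_edge, ← hpq, he]
        exact ⟨rfl, huw.ne⟩
      · right
        rw [SimpleGraph.adj_edge, ← hrs, he]
        exact ⟨rfl, huw.ne⟩
    · left; left
      rw [hKdef, SimpleGraph.deleteEdges_adj]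
      exact ⟨huw, hm⟩
  have h3 := graphNorm_mono hle
  have hs : √(2:ℝ) ≤ √3 := Real.sqrt_le_sqrt (by norm_num)
  have hs1 : 1 ≤ √(2:ℝ) := by rw [Real.one_le_sqrt]; norm_num
  -- The two deleted edges may coincide, and then only one is restored.
  by_cases hac : s(p, q) = s(r, s)
  · have : K ⊔ SimpleGraph.edge p q ⊔ SimpleGraph.edge r s = K ⊔ SimpleGraph.edge r s := by
      rw [sup_assoc, show SimpleGraph.edge p q = SimpleGraph.edge r s by
        rw [SimpleGraph.edge, SimpleGraph.edge, hac], sup_idem]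
    rw [this] at h3
    have := graphNorm_sup_edge_le K r s
    linarith
  · have := graphNorm_sup_edge_sup_edge_le K hac
    linarith

/-- In the exceptional case connectedness makes the three triangle edges all the edges of G. They
meet pairwise, contrary to the non-adjacent pair a, b. -/
theorem graphNorm_le_of_lineGraph_iso [Finite V] [Finite W] {G : SimpleGraph V}
    {G' : SimpleGraph W} (ψ : G.lineGraph ≃g G'.lineGraph) (hG : G.lineGraph.Preconnected)
    {a b : G.edgeSet} (hab : a ≠ b) (hnadj : ¬ G.lineGraph.Adj a b) :
    graphNorm G ≤ graphNorm G' := by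
  obtain ⟨φ, h⟩ := exists_incidencePreserving_deleteEdges (G := G) (G' := G') ψ ψ.injective ∅
    (fun e f _ _ => ψ.map_adj_iff.symm) (Quot.out (ψ a).1).1
  simp only [Set.image_empty, SimpleGraph.deleteEdges_empty] at h
  rcases h.graphNorm_le with hle | ⟨x, y, z, p, ht, h2⟩
  · exact hle
  exfalso
  have hall := hG.mem_of_closed (S := {e | e.1 ∈ ({s(x, y), s(x, z), s(y, z)} : Set (Sym2 V))})
    (a := ⟨s(x, y), ht.adj_xy⟩) (Or.inl rfl) (by
      intro e f he hef
      obtain ⟨-, u, hu1, hu2⟩ := SimpleGraph.lineGraph_adj_iff_exists.1 hef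
      exact ht.mem_of_meet (e := e.1) (f := f.1) he f.2 hu1 hu2)
  refine hnadj (SimpleGraph.lineGraph_adj_iff_exists.2 ⟨hab, ?_⟩)
  have ha := hall a
  have hb := hall b
  rcases ha with ha | ha | ha <;> rcases hb with hb | hb | hb <;> rw [ha, hb] <;> simp

end NormComparison

/-! ### Edge augmentation of line graphs and the four cases. -/

section EdgeAugmentation

variable {V : Type u} {W : Type v}

theorem IsAddEdge.lt {F F' : SimpleGraph V} (h : IsAddEdge F F') : F < F' := by
  obtain ⟨a, b, hab, hnadj, rfl⟩ := h
  exact F.lt_sup_edge a b hab hnadj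

theorem IsAddEdge.graphNorm_le [Finite V] {F F' : SimpleGraph V} (h : IsAddEdge F F') :
    graphNorm F' ≤ graphNorm F + 1 := by
  obtain ⟨a, b, -, -, rfl⟩ := h
  exact graphNorm_sup_edge_le F a b

/-- Avoiding one end of the added edge is enough, so deleting a single edge of the root hides the
change. -/
theorem sup_edge_adj_iff_of_ne {F : SimpleGraph V} {a b e f : V} (he : e ≠ a) (hf : f ≠ a) :
    (F ⊔ SimpleGraph.edge a b).Adj e f ↔ F.Adj e f := by
  simp [SimpleGraph.edge_adj, he, hf]

/-- If a line graph becomes the line graph of `G'` by adding one edge, the spectral radii of the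
root graphs differ by at most one. -/
theorem abs_graphNorm_sub_le_one_of_lineGraph_iso_sup_edge [Finite V] [Finite W]
    {G : SimpleGraph V} {G' : SimpleGraph W} (hG : G.Connected) (a b : G.edgeSet)
    (ψ : G'.lineGraph ≃g G.lineGraph ⊔ SimpleGraph.edge a b) :
    |graphNorm G' - graphNorm G| ≤ 1 := by
  have hL := hG.preconnected_lineGraph
  have hconn : ∀ S : Set G.edgeSet, S.Nonempty → a ∉ S →
      (∀ e f, e ∈ S → f ≠ a → G.lineGraph.Adj e f → f ∈ S) → ∃ e ∈ S, G.lineGraph.Adj e a := by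
    rintro S ⟨s, hs⟩ ha hS
    by_contra! hcon
    refine ha (hL.mem_of_closed hs (fun e f he hef => hS e f he ?_ hef) a)
    rintro rfl
    exact hcon e he hef
  have hne : ∀ e t, e ≠ ψ.symm t → ψ e ≠ t := fun e t he h => he (by
    rw [← h, RelIso.symm_apply_apply])
  rw [abs_sub_le_iff]
  constructor
  · have := graphNorm_le_add_one_of_adj_iff_off_edge (G := G') (G' := G) ψ ψ.injective (ψ.symm a)
      (fun e f he hf => by
        rw [← ψ.map_adj_iff, sup_edge_adj_iff_of_ne (hne e a he) (hne f a hf)])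
      -- The attachment condition is carried over from L(G), whose edges all survive in the larger
      -- graph.
      (fun S hS ha hclosed => by
        obtain ⟨_, ⟨e, he, rfl⟩, hea⟩ := hconn (ψ '' S) (hS.image _)
          (by rintro ⟨e, he, hea⟩; exact hne e a (by rintro rfl; exact ha he) hea) (by
            rintro _ f ⟨e, he, rfl⟩ hf hef
            refine ⟨ψ.symm f, hclosed e _ he (by simpa using hf) ?_, by simp⟩
            rw [← ψ.map_adj_iff, RelIso.apply_symm_apply]
            exact Or.inl hef)
        refine ⟨e, he, ?_⟩
        rw [← ψ.map_adj_iff, RelIso.apply_symm_apply]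
        exact Or.inl hea)
    linarith
  · have := graphNorm_le_add_one_of_adj_iff_off_edge (G := G) (G' := G') ψ.symm ψ.symm.injective a
      (fun e f he hf => by
        rw [← ψ.map_adj_iff, RelIso.apply_symm_apply, RelIso.apply_symm_apply,
          sup_edge_adj_iff_of_ne he hf]) hconn
    linarith

/-- L(G) and F can differ only at the pairs ab and cd, hence agree away from a and c. -/
theorem abs_graphNorm_sub_le_two_of_relocated_edge [Finite V] [Finite W]
    {G : SimpleGraph V} {G' : SimpleGraph W} {F : SimpleGraph G.edgeSet} {a b c d : G.edgeSet}
    (hF : G.lineGraph ⊔ SimpleGraph.edge a b = F ⊔ SimpleGraph.edge c d)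
    (ψ : G'.lineGraph ≃g F) : |graphNorm G' - graphNorm G| ≤ 2 := by
  have hadj : ∀ e f, e ≠ a → e ≠ c → f ≠ a → f ≠ c → (G.lineGraph.Adj e f ↔ F.Adj e f) := by
    intro e f hea hec hfa hfc
    rw [← sup_edge_adj_iff_of_ne (F := F) (b := d) hec hfc, ← hF, sup_edge_adj_iff_of_ne hea hfa]
  have hne : ∀ e t, e ≠ ψ.symm t → ψ e ≠ t := fun e t he h => he (by
    rw [← h, RelIso.symm_apply_apply])
  rw [abs_sub_le_iff]
  constructor
  · have := graphNorm_le_add_two_of_adj_iff_off_edges (G := G') (G' := G) ψ ψ.injective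
      (ψ.symm a) (ψ.symm c) (fun e f h1 h2 h3 h4 => by
        rw [← ψ.map_adj_iff, hadj _ _ (hne e a h1) (hne e c h2) (hne f a h3) (hne f c h4)])
    linarith
  · have := graphNorm_le_add_two_of_adj_iff_off_edges (G := G) (G' := G') ψ.symm ψ.symm.injective
      a c (fun e f h1 h2 h3 h4 => by
        rw [← ψ.map_adj_iff, RelIso.apply_symm_apply, RelIso.apply_symm_apply, hadj e f h1 h2 h3 h4])
    linarith

/-- A form of Whitney's theorem: the spectral radius of the root of a connected, non-complete
line graph is determined by the line graph. -/
theorem graphNorm_eq_of_lineGraph_iso [Finite V] [Finite W] {G : SimpleGraph V}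
    {G' : SimpleGraph W} (ψ : G'.lineGraph ≃g G.lineGraph) (hG : G.lineGraph.Preconnected)
    {a b : G.edgeSet} (hab : a ≠ b) (hnadj : ¬ G.lineGraph.Adj a b) :
    graphNorm G' = graphNorm G := by
  refine le_antisymm ?_ (graphNorm_le_of_lineGraph_iso ψ.symm hG hab hnadj)
  refine graphNorm_le_of_lineGraph_iso ψ (ψ.preconnected_iff.2 hG) (a := ψ.symm a)
    (b := ψ.symm b) (by simpa using hab) ?_
  rwa [ψ.symm.map_adj_iff]

open Classical in
/-- The change of the spectral radius between two finite graphs on the same vertices. -/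
noncomputable def graphNormChange (H Hhat : SimpleGraph V) : ℝ :=
  -- The constants of the theorem range over all vertex types; the value 1 on infinite ones plays no
  -- role.
  if _ : Finite V then |graphNorm Hhat - graphNorm H| else 1

theorem graphNormChange_eq [h : Finite V] (H Hhat : SimpleGraph V) :
    graphNormChange H Hhat = |graphNorm Hhat - graphNorm H| := by
  rw [graphNormChange, dif_pos h]

end EdgeAugmentation

theorem theorem6 :
    ∃ (C_G : ∀ (V : Type u) (W : Type v), SimpleGraph V → SimpleGraph W → ℝ)
      (C_H : ∀ U : Type u, SimpleGraph U → SimpleGraph U → ℝ)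
      (C : ∀ U : Type u, SimpleGraph U → SimpleGraph U → SimpleGraph U → ℝ),
      ∀ (V : Type u) (W : Type v) [Finite V] [Finite W] (G : SimpleGraph V)
        (Htilde : SimpleGraph G.edgeSet) (Ghat : SimpleGraph W) (Hhat : SimpleGraph G.edgeSet),
        G.Connected → EdgeAugmented G Htilde Ghat Hhat →
        -- Case I: the perturbed graph is already a line graph
        (Nonempty (Hhat ≃g Htilde) →
          (0 < C_G V W G Ghat ∧ C_G V W G Ghat ≤ 1) ∧
          (0 < C_H G.edgeSet G.lineGraph Hhat ∧ C_H G.edgeSet G.lineGraph Hhat ≤ 1) ∧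
          |graphNorm Ghat - graphNorm G| / C_G V W G Ghat ≤
            |graphNorm Hhat - graphNorm G.lineGraph| / C_H G.edgeSet G.lineGraph Hhat ∧
          |graphNorm Hhat - graphNorm G.lineGraph| / C_H G.edgeSet G.lineGraph Hhat ≤ 1) ∧
        -- Case II: an edge is deleted, which undoes the perturbation
        (IsAddEdge Hhat Htilde → Nonempty (Hhat ≃g G.lineGraph) →
          graphNorm Hhat = graphNorm G.lineGraph ∧ graphNorm Ghat = graphNorm G) ∧
        -- Case III: an edge is deleted, which relocates an edge
        (IsAddEdge Hhat Htilde → IsEmpty (Hhat ≃g G.lineGraph) →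
          |graphNorm Hhat - graphNorm G.lineGraph| ≤ 1 ∧
          |graphNorm Ghat - graphNorm G| ≤ 2) ∧
        -- Case IV: a second edge is added
        (IsAddEdge Htilde Hhat →
          0 < C G.edgeSet G.lineGraph Htilde Hhat ∧
          C G.edgeSet G.lineGraph Htilde Hhat ≤ |graphNorm Hhat - graphNorm G.lineGraph| ∧
          |graphNorm Hhat - graphNorm G.lineGraph| ≤ 2) := by
  -- With C_H equal to the change itself, the middle ratio of Case I is exactly 1.
  refine ⟨fun _ _ _ _ => 1,
    fun _ H Hhat => graphNormChange H Hhat,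
    fun _ H _ Hhat => graphNormChange H Hhat, ?_⟩
  intro V W _ _ G Htilde Ghat Hhat hG hE
  have hL := hG.preconnected_lineGraph
  have hadd := hE.augment
  have hup := hadd.graphNorm_le
  have hlt := graphNorm_lt_of_lt hL hadd.lt
  obtain ⟨ψ⟩ := hE.pseudoInverse.lineGraph_iso
  simp only [graphNormChange_eq]
  refine ⟨?_, ?_, ?_, ?_⟩
  · rintro ⟨θ⟩
    have hpos : 0 < graphNorm Hhat - graphNorm G.lineGraph := by
      rw [graphNorm_congr θ]; linarith
    have hle : graphNorm Hhat - graphNorm G.lineGraph ≤ 1 := by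
      rw [graphNorm_congr θ]; linarith
    obtain ⟨a, b, -, -, rfl⟩ := hadd
    have h1 := abs_graphNorm_sub_le_one_of_lineGraph_iso_sup_edge hG a b (ψ.trans θ)
    rw [abs_of_pos hpos, div_self hpos.ne', div_one]
    exact ⟨⟨one_pos, le_rfl⟩, ⟨hpos, hle⟩, h1, le_rfl⟩
  · rintro - ⟨θ⟩
    obtain ⟨a, b, hab, hnadj, -⟩ := hadd
    exact ⟨graphNorm_congr θ, graphNorm_eq_of_lineGraph_iso (ψ.trans θ) hL hab hnadj⟩
  -- H and Ĥ both arise from H̃ by deleting one edge, so both radii lie between ‖H̃‖ - 1 and ‖H̃‖.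
  · intro hdel _
    have h1 := hdel.graphNorm_le
    have h2 := graphNorm_mono hdel.lt.le
    obtain ⟨a, b, -, -, rfl⟩ := hadd
    obtain ⟨c, d, -, -, hF⟩ := hdel
    refine ⟨?_, abs_graphNorm_sub_le_two_of_relocated_edge hF ψ⟩
    rw [abs_sub_le_iff]
    constructor <;> linarith
  · intro hadd'
    have h1 := hadd'.graphNorm_le
    have h2 := graphNorm_mono hadd'.lt.le
    have hpos : 0 < graphNorm Hhat - graphNorm G.lineGraph := by linarith
    rw [abs_of_pos hpos]
    exact ⟨hpos, le_rfl, by linarith⟩
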